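/- Let $G$ be a countable discrete abelian group. A Følner sequence in $G$ is a sequence $(F_N)$ of nonempty finite subsets of $G$ with $|F_N\triangle(g+F_N)|/|F_N|\to 0$ for every $g\in G$. The upper Banach density of $A\subset G$ is $d^*(A)=\sup_{(F_N)}\limsup_{N\to\infty}|A\cap F_N|/|F_N|$, the supremum being over all Følner sequences. For bounded $u:G\to\mathbb R$ we say that $UC\text{-}\lim_{g\in G}u(g)$ exists and equals $L$ if $\frac1{|F_N|}\sum_{g\in F_N}u(g)\to L$ for every Følner sequence $(F_N)$. An ergodic $G$-system $(X,\mu,T)$ is a separable probability space $(X,\mu)$ (that is, its $\sigma$-algebra is countably generated modulo null sets) with an action $T=(T_g)_{g\in G}$ of $G$ by measurable $\mu$-preserving transformations such that every measurable $B\subset X$ with $\mu(B\triangle T_g^{-1}B)=0$ for all $g\in G$ has $\mu(B)\in\{0,1\}$. Write $T_gf=f\circ T_g$. **Proposition (First correspondence principle).** Let $G$ be a countable abelian group and let $A\subset G$ with $d^*(A)>0$. Let $\phi_1,\phi_2,\phi_3:G\to G$ be pairwise commuting endomorphisms whose images have finite index in $G$ and such that $\phi_1+\phi_2+\phi_3=0$.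 Then there are an ergodic $G$-system $(X,\mu,T)$ and a measurable function $f:X\to[0,1]$ with $\int_X f\,d\mu=d^*(A)$ such that for every $w\in G$ the limit $$I(w):=UC\text{-}\lim_{g\in G}\int_X f\cdot T_{\phi_3(g)}f\cdot T_{w-\phi_2(g)}f\,d\mu$$ exists and lies in $[0,1]$, and the function $I:G\to[0,1]$ satisfies $$\phi_3(\operatorname{supp} I)\subset \phi_1(A)+\phi_2(A)+\phi_3(A),$$ where $\operatorname{supp} I=\{w\in G: I(w)\neq 0\}$. -/

import Mathlib

open MeasureTheory Filter Topology
open scoped Pointwise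

universe u

noncomputable section

variable {G : Type u} [AddCommGroup G]

open scoped Classical in
/-- A Følner sequence: nonempty finite sets `F N ⊆ G` such that, for every `g`,
`|F N ∆ (g + F N)| / |F N| → 0`. -/
structure IsFolnerSeq (F : ℕ → Finset G) : Prop where
  nonempty : ∀ N, (F N).Nonempty
  tendsto_symmDiff : ∀ g : G,
    Tendsto (fun N => ((symmDiff (F N) ((F N).image (fun x => g + x))).card : ℝ) / ((F N).card : ℝ))
      atTop (𝓝 0)

open scoped Classical in
/-- The upper density of `A` along `F`: the limsup of `|A ∩ F N| / |F N|`. -/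
def upperDensityAlong (F : ℕ → Finset G) (A : Set G) : ℝ :=
  limsup (fun N => (((F N).filter (fun x => x ∈ A)).card : ℝ) / ((F N).card : ℝ)) atTop

/-- The upper Banach density `d*(A)`: the supremum of the upper densities of `A` along all Følner
sequences. -/
def upperBanachDensity (A : Set G) : ℝ :=
  sSup {d : ℝ | ∃ F : ℕ → Finset G, IsFolnerSeq F ∧ d = upperDensityAlong F A}

/-- `HasUCLim u L` says that `u` has a uniform Cesàro average and `UC-lim_{g ∈ G} u g = L`: along
every Følner sequence the averages of `u` converge, to the same limit `L`. -/
def HasUCLim (u : G → ℝ) (L : ℝ) : Prop :=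
  ∀ F : ℕ → Finset G, IsFolnerSeq F →
    Tendsto (fun N => (∑ g ∈ F N, u g) / ((F N).card : ℝ)) atTop (𝓝 L)

/-- `(X, μ, T)`, with `T_g x = g +ᵥ x`, is an ergodic measure preserving `G`-system: `μ` is a
probability measure, separable (countably generated modulo null sets), each `T_g` is measurable and
preserves `μ`, and sets invariant modulo `μ` under every `T_g` are null or conull. -/
structure IsErgodicSystem (G : Type u) [AddCommGroup G] (X : Type u) [MeasurableSpace X]
    [AddAction G X] (μ : Measure X) : Prop where
  isProbabilityMeasure : IsProbabilityMeasure μ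
  isSeparable : MeasureTheory.IsSeparable μ
  measurable_vadd : ∀ g : G, Measurable (fun x : X => g +ᵥ x)
  ergodic : ErgodicVAdd G X μ

end

/-!
The system is the shift on the space of `0`-`1` sequences indexed by `G`, and `f` is the indicator
of the sequences with value `1` at the origin.

**The measure.** Among the invariant measures carried by the orbit closure of the indicator of `A`,
the largest measure of `{f = 1}` is `d*(A)`: limits of empirical measures along Følner sequences
attain it (`exists_measureReal_cylinder_eq`), and averaging an invariant measure over a Følner set,
and translating that set, shows that it cannot be exceeded (`measureReal_cylinder_le`). An extreme
point of the compact set of maximizing measures is ergodic (`exists_ergodic_of_isMax`).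

**The inclusion.** If `I w ≠ 0`, some triple correlation is nonzero, so some `t` in `G` has `t`,
`t + φ₃ g` and `t + w - φ₂ g` in `A`. As `φ₁ + φ₂ + φ₃ = 0` and `φ₂ φ₃ = φ₃ φ₂`, the element
`φ₁ t + φ₂ (t + φ₃ g) + φ₃ (t + w - φ₂ g)` equals `φ₃ w`.

**Existence of the limit** (`hasCauchyAvg_triple_correlation`). In the real Hilbert space `L²`, the
function in the middle is split into an almost periodic part for `g ↦ T_{φ₃ g}` (the orbit stays
near finite-dimensional subspaces) and its orthogonal complement.
* For the almost periodic part the correlations are uniform limits of finite sums of products of two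
  matrix coefficients. These have averages by the mean ergodic theorem in a tensor product; see
  `hasCauchyAvg_inner_of_mem_almostPeriodic`.
* A vector orthogonal to the almost periodic ones is weakly mixing
  (`IsIsometricRep.tendsto_orbitOperator`), and its contribution tends to zero. By van der Corput's
  lemma one has to average correlations that depend on `g` only through `T_{φ₁ g}`. As `φ₁(G)` has
  finite index and `G` acts ergodically, the `φ₁(G)`-invariant functions are constant on the members
  of a finite partition of unity (`exists_partition_of_finiteIndex`). Thus the correlations are
  bounded by finitely many matrix coefficients of the weakly mixing vector, which are small on
  average.

Averages along all Følner sequences are treated at once by means of the filter `folnerFilter`.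
-/

/-! ### Averages and the Følner filter -/

noncomputable section Averages

variable {G : Type*} {E E' : Type*} [NormedAddCommGroup E] [NormedSpace ℝ E]
  [NormedAddCommGroup E'] [NormedSpace ℝ E']

/-- The average of `u` over the finite set `F` (zero if `F` is empty). -/
def avg (F : Finset G) (u : G → E) : E := (F.card : ℝ)⁻¹ • ∑ g ∈ F, u g

lemma avg_add (F : Finset G) (u v : G → E) :
    avg F (fun g => u g + v g) = avg F u + avg F v := by
  simp [avg, Finset.sum_add_distrib]

lemma avg_sub (F : Finset G) (u v : G → E) :
    avg F (fun g => u g - v g) = avg F u - avg F v := by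
  simp [avg, Finset.sum_sub_distrib, smul_sub]

lemma avg_smul (F : Finset G) (c : ℝ) (u : G → E) :
    avg F (fun g => c • u g) = c • avg F u := by
  simp only [avg, ← Finset.smul_sum, smul_comm c]

lemma avg_const {F : Finset G} (hF : F.Nonempty) (c : E) : avg F (fun _ => c) = c := by
  have : (F.card : ℝ) ≠ 0 := by exact_mod_cast hF.card_pos.ne'
  rw [avg, Finset.sum_const, ← Nat.cast_smul_eq_nsmul ℝ, smul_smul, inv_mul_cancel₀ this, one_smul]

lemma map_avg (L : E →L[ℝ] E') (F : Finset G) (u : G → E) :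
    L (avg F u) = avg F (fun g => L (u g)) := by
  simp [avg]

lemma avg_comm {G' : Type*} (F : Finset G) (F' : Finset G') (u : G → G' → E) :
    avg F (fun g => avg F' (u g)) = avg F' (fun h => avg F (fun g => u g h)) := by
  simp only [avg, ← Finset.smul_sum]
  rw [smul_comm, Finset.sum_comm]

lemma avg_sum {ι : Type*} (s : Finset ι) (F : Finset G) (u : ι → G → E) :
    avg F (fun g => ∑ i ∈ s, u i g) = ∑ i ∈ s, avg F (u i) := by
  simp only [avg]
  rw [Finset.sum_comm, Finset.smul_sum]

lemma avg_mono {F : Finset G} {u v : G → ℝ} (h : ∀ g ∈ F, u g ≤ v g) : avg F u ≤ avg F v := by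
  simp only [avg, smul_eq_mul]
  gcongr with g hg
  exact h g hg

lemma avg_nonneg {F : Finset G} {u : G → ℝ} (h : ∀ g ∈ F, 0 ≤ u g) : 0 ≤ avg F u := by
  simp only [avg, smul_eq_mul]
  exact mul_nonneg (by positivity) (Finset.sum_nonneg h)

lemma norm_avg_le_avg_norm (F : Finset G) (u : G → E) : ‖avg F u‖ ≤ avg F (fun g => ‖u g‖) := by
  rw [avg, norm_smul, avg, smul_eq_mul, Real.norm_of_nonneg (by positivity)]
  gcongr
  exact norm_sum_le _ _

lemma norm_avg_le {F : Finset G} {u : G → E} {C : ℝ} (hC : 0 ≤ C) (h : ∀ g ∈ F, ‖u g‖ ≤ C) :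
    ‖avg F u‖ ≤ C := by
  rcases F.eq_empty_or_nonempty with rfl | hF
  · simpa [avg] using hC
  · exact (norm_avg_le_avg_norm F u).trans ((avg_mono h).trans_eq (avg_const hF C))

lemma sq_avg_le (F : Finset G) (u : G → ℝ) : (avg F u) ^ 2 ≤ avg F (fun g => u g ^ 2) := by
  rcases F.eq_empty_or_nonempty with rfl | hF
  · simp [avg]
  have hc : (0 : ℝ) < F.card := by exact_mod_cast hF.card_pos
  have := sq_sum_le_card_mul_sum_sq (s := F) (f := u)
  simp only [avg, smul_eq_mul, mul_pow]
  calc (F.card : ℝ)⁻¹ ^ 2 * (∑ g ∈ F, u g) ^ 2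
      ≤ (F.card : ℝ)⁻¹ ^ 2 * (F.card * ∑ g ∈ F, u g ^ 2) := by gcongr
    _ = (F.card : ℝ)⁻¹ * ∑ g ∈ F, u g ^ 2 := by field_simp

lemma norm_avg_sq_le (F : Finset G) (u : G → E) :
    ‖avg F u‖ ^ 2 ≤ avg F (fun g => ‖u g‖ ^ 2) :=
  (pow_le_pow_left₀ (norm_nonneg _) (norm_avg_le_avg_norm F u) 2).trans (sq_avg_le F _)

lemma avg_eq_div (F : Finset G) (u : G → ℝ) : avg F u = (∑ g ∈ F, u g) / F.card := by
  rw [avg, smul_eq_mul, div_eq_inv_mul]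

end Averages

noncomputable section FolnerFilter

variable {G : Type*} [AddCommGroup G] {E : Type*} [NormedAddCommGroup E] [NormedSpace ℝ E]

open scoped Classical in
/-- The relative size of the boundary of `F` under translation by `g`. -/
def folnerDefect (g : G) (F : Finset G) : ℝ :=
  ((symmDiff F (F.image (fun x => g + x))).card : ℝ) / (F.card : ℝ)

variable (G) in
/-- The filter on finite subsets of `G` generated by the nonempty `(K, δ)`-invariant sets. Følner
sequences are the sequences of nonempty sets converging along this filter. -/
def folnerFilter : Filter (Finset G) :=
  𝓟 {F | F.Nonempty} ⊓ ⨅ g : G, comap (folnerDefect g) (𝓝 0)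

lemma eventually_nonempty_folnerFilter : ∀ᶠ F in folnerFilter G, F.Nonempty :=
  mem_inf_of_left (mem_principal_self _)

lemma tendsto_folnerDefect (g : G) : Tendsto (folnerDefect g) (folnerFilter G) (𝓝 0) :=
  tendsto_comap.mono_left (inf_le_right.trans (iInf_le _ g))

lemma IsFolnerSeq.tendsto {G : Type u} [AddCommGroup G] {F : ℕ → Finset G} (hF : IsFolnerSeq F) :
    Tendsto F atTop (folnerFilter G) := by
  refine tendsto_inf.2 ⟨tendsto_principal.2 (Eventually.of_forall hF.nonempty), ?_⟩
  exact tendsto_iInf.2 fun g => tendsto_comap_iff.2 (hF.tendsto_symmDiff g)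

lemma norm_avg_shift_sub_le {u : G → E} {C : ℝ} (hu : ∀ g, ‖u g‖ ≤ C) (g : G) (F : Finset G) :
    ‖avg F (fun x => u (g + x)) - avg F u‖ ≤ C * folnerDefect g F := by
  classical
  set F' := F.image (fun x => g + x) with hF'
  have h1 : ∑ x ∈ F, u (g + x) = ∑ y ∈ F', u y := by
    rw [hF', Finset.sum_image]
    intro a _ b _ h
    exact add_left_cancel h
  have h2 : ∑ y ∈ F', u y - ∑ y ∈ F, u y = ∑ y ∈ F' \ F, u y - ∑ y ∈ F \ F', u y :=
    Finset.sum_sdiff_sub_sum_sdiff.symm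
  have h3 : ((symmDiff F F').card : ℝ) = (F' \ F).card + (F \ F').card := by
    rw [Finset.symmDiff_def, Finset.card_union_of_disjoint disjoint_sdiff_sdiff]
    push_cast; ring
  have h4 : ‖∑ y ∈ F', u y - ∑ y ∈ F, u y‖ ≤ C * (symmDiff F F').card := by
    rw [h2, h3]
    refine (norm_sub_le _ _).trans ?_
    have a1 := norm_sum_le_of_le (F' \ F) (fun y _ => hu y)
    have a2 := norm_sum_le_of_le (F \ F') (fun y _ => hu y)
    simp only [Finset.sum_const, nsmul_eq_mul] at a1 a2
    nlinarith
  rw [avg, avg, ← smul_sub, norm_smul, h1, Real.norm_of_nonneg (by positivity)]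
  calc (F.card : ℝ)⁻¹ * ‖∑ y ∈ F', u y - ∑ y ∈ F, u y‖
      ≤ (F.card : ℝ)⁻¹ * (C * (symmDiff F F').card) := by gcongr
    _ = C * folnerDefect g F := by
      simp only [folnerDefect, ← hF', div_eq_inv_mul]
      ring_nf

/-- Averages of a bounded function along the Følner filter are asymptotically shift invariant. -/
lemma tendsto_avg_shift_sub {u : G → E} {C : ℝ} (hu : ∀ g, ‖u g‖ ≤ C) (g : G) :
    Tendsto (fun F => avg F (fun x => u (g + x)) - avg F u) (folnerFilter G) (𝓝 0) := by
  refine squeeze_zero_norm (norm_avg_shift_sub_le hu g) ?_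
  simpa using (tendsto_folnerDefect g).const_mul C

/-- The averages of `u` form a Cauchy net along the Følner filter. -/
def HasCauchyAvg (u : G → E) : Prop :=
  ∀ ε > 0, ∃ S ∈ folnerFilter G, ∀ F ∈ S, ∀ F' ∈ S, ‖avg F u - avg F' u‖ ≤ ε

lemma HasCauchyAvg.exists_tendsto [CompleteSpace E] {u : G → E} (hu : HasCauchyAvg u) :
    ∃ l, Tendsto (fun F => avg F u) (folnerFilter G) (𝓝 l) := by
  rcases (folnerFilter G).eq_or_neBot with h | h
  · exact ⟨0, by simp [h]⟩
  refine cauchy_map_iff_exists_tendsto.1 (Metric.cauchy_iff.2 ⟨inferInstance, fun ε hε => ?_⟩)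
  obtain ⟨S, hS, h⟩ := hu (ε / 2) (by positivity)
  refine ⟨(fun F => avg F u) '' S, image_mem_map hS, ?_⟩
  rintro _ ⟨F, hF, rfl⟩ _ ⟨F', hF', rfl⟩
  rw [dist_eq_norm]
  linarith [h F hF F' hF']

lemma Filter.Tendsto.hasCauchyAvg {u : G → E} {l : E}
    (h : Tendsto (fun F => avg F u) (folnerFilter G) (𝓝 l)) : HasCauchyAvg u := by
  intro ε hε
  refine ⟨_, Metric.tendsto_nhds.1 h (ε / 2) (by positivity), fun F hF F' hF' => ?_⟩
  rw [← dist_eq_norm]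
  have h1 : dist (avg F u) l < ε / 2 := hF
  have h2 : dist (avg F' u) l < ε / 2 := hF'
  linarith [dist_triangle_right (avg F u) (avg F' u) l]

lemma HasCauchyAvg.add {u v : G → E} (hu : HasCauchyAvg u) (hv : HasCauchyAvg v) :
    HasCauchyAvg (fun g => u g + v g) := by
  intro ε hε
  obtain ⟨S, hS, h⟩ := hu (ε / 2) (by positivity)
  obtain ⟨S', hS', h'⟩ := hv (ε / 2) (by positivity)
  refine ⟨S ∩ S', inter_mem hS hS', fun F hF F' hF' => ?_⟩
  rw [avg_add, avg_add, add_sub_add_comm]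
  linarith [norm_add_le (avg F u - avg F' u) (avg F v - avg F' v), h F hF.1 F' hF'.1,
    h' F hF.2 F' hF'.2]

lemma HasCauchyAvg.sum {ι : Type*} (s : Finset ι) {u : ι → G → E}
    (hu : ∀ i ∈ s, HasCauchyAvg (u i)) : HasCauchyAvg (fun g => ∑ i ∈ s, u i g) := by
  classical
  induction s using Finset.induction_on with
  | empty => exact fun ε hε => ⟨_, univ_mem, fun F _ F' _ => by simpa [avg] using hε.le⟩
  | insert a s ha ih =>
    simp only [Finset.sum_insert ha]
    exact (hu a (by simp)).add (ih fun i hi => hu i (by simp [hi]))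

/-- Having Cauchy averages is closed under uniform limits. -/
lemma HasCauchyAvg.of_approx {u : G → E}
    (h : ∀ ε > 0, ∃ v : G → E, HasCauchyAvg v ∧ ∀ g, ‖u g - v g‖ ≤ ε) : HasCauchyAvg u := by
  intro ε hε
  obtain ⟨v, hv, huv⟩ := h (ε / 3) (by positivity)
  obtain ⟨S, hS, h⟩ := hv (ε / 3) (by positivity)
  refine ⟨S, hS, fun F hF F' hF' => ?_⟩
  have h1 : ∀ F : Finset G, ‖avg F u - avg F v‖ ≤ ε / 3 := fun F => by
    rw [← avg_sub]; exact norm_avg_le (by positivity) fun g _ => huv g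
  have := norm_add₃_le (a := avg F u - avg F v) (b := avg F v - avg F' v)
    (c := -(avg F' u - avg F' v))
  rw [norm_neg] at this
  calc ‖avg F u - avg F' u‖
      = ‖(avg F u - avg F v) + (avg F v - avg F' v) + -(avg F' u - avg F' v)‖ := by
        congr 1; abel
    _ ≤ ε := by linarith [h1 F, h1 F', h F hF F' hF']

end FolnerFilter

/-! ### Isometric representations: mean ergodic theorem and weak mixing -/

noncomputable section IsometricRepresentations

open scoped TensorProduct

variable {G : Type*} [AddCommGroup G]
  {H : Type*} [NormedAddCommGroup H] [InnerProductSpace ℝ H]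
  {H' : Type*} [NormedAddCommGroup H'] [InnerProductSpace ℝ H']

/-- `U` is a representation of the additive group `G` by linear isometries. -/
structure IsIsometricRep (U : G → H →ₗᵢ[ℝ] H) : Prop where
  zero_apply : ∀ x, U 0 x = x
  add_apply : ∀ g h x, U (g + h) x = U g (U h x)

lemma abs_inner_sub_inner_le (x y z : H) :
    |inner ℝ x y - inner ℝ x z| ≤ ‖x‖ * ‖y - z‖ := by
  rw [← inner_sub_right]
  exact abs_real_inner_le_norm _ _

namespace IsIsometricRep

variable {U : G → H →ₗᵢ[ℝ] H} {V : G → H' →ₗᵢ[ℝ] H'}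

lemma comp {G' : Type*} [AddCommGroup G'] (hU : IsIsometricRep U) (φ : G' →+ G) :
    IsIsometricRep (fun g => U (φ g)) :=
  ⟨fun x => by simp [hU.zero_apply], fun g h x => by simp [hU.add_apply]⟩

lemma inner_eq (hU : IsIsometricRep U) (g : G) (x y : H) :
    inner ℝ (U g x) y = inner ℝ x (U (-g) y) := by
  rw [← (U (-g)).inner_map_map, ← hU.add_apply, neg_add_cancel, hU.zero_apply]

lemma tensor (hU : IsIsometricRep U) (hV : IsIsometricRep V) :
    IsIsometricRep (fun g => TensorProduct.mapIsometry (U g) (V g)) := by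
  constructor
  · intro x
    induction x with
    | zero => simp
    | tmul a b => simp [hU.zero_apply, hV.zero_apply]
    | add a b ha hb => rw [map_add, ha, hb]
  · intro g h x
    induction x with
    | zero => simp
    | tmul a b => simp [hU.add_apply, hV.add_apply]
    | add a b ha hb => simp only [map_add, ha, hb]

omit [AddCommGroup G] in
lemma avg_mem_convexHull (v : H) {F : Finset G} (hF : F.Nonempty) :
    avg F (fun g => U g v) ∈ convexHull ℝ (Set.range fun g => U g v) := by
  have hc : (F.card : ℝ) ≠ 0 := by exact_mod_cast hF.card_pos.ne'
  rw [avg, Finset.smul_sum]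
  refine (convex_convexHull ℝ _).sum_mem (fun _ _ => by positivity) ?_
    fun g _ => subset_convexHull ℝ _ ⟨g, rfl⟩
  rw [Finset.sum_const, nsmul_eq_mul, mul_inv_cancel₀ hc]

/-- Every element of the convex hull of an orbit has asymptotically the same averages. -/
lemma tendsto_avg_sub_of_mem_convexHull (hU : IsIsometricRep U) {v c : H}
    (hc : c ∈ convexHull ℝ (Set.range fun g => U g v)) :
    Tendsto (fun F => avg F (fun g => U g c) - avg F (fun g => U g v)) (folnerFilter G) (𝓝 0) := by
  set T : Set H := {c | Tendsto (fun F => avg F (fun g => U g c) - avg F (fun g => U g v))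
    (folnerFilter G) (𝓝 0)}
  have hT : convexHull ℝ (Set.range fun g => U g v) ⊆ T := by
    refine convexHull_min ?_ ?_
    · rintro _ ⟨h, rfl⟩
      have := tendsto_avg_shift_sub (u := fun g => U g v) (C := ‖v‖) (fun g => by simp) h
      refine this.congr fun F => ?_
      simp only [add_comm h, hU.add_apply]
    · intro x hx y hy a b _ _ hab
      have := (Tendsto.const_smul hx a).add (Tendsto.const_smul hy b)
      simp only [smul_zero, add_zero] at this
      refine Tendsto.congr (fun F => ?_) this
      simp only [map_add, map_smul, avg_add, avg_smul, smul_sub]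
      have h3 : avg F (fun g => U g v) = a • avg F (fun g => U g v) + b • avg F (fun g => U g v) := by
        rw [← add_smul, hab, one_smul]
      nth_rewrite 3 [h3]
      abel
  exact hT hc

/-- The mean ergodic theorem: almost minimal elements of the convex hull of the orbit have
averages that are again almost minimal, and by the parallelogram identity almost minimal elements
of a convex set are close to each other. -/
theorem hasCauchyAvg (hU : IsIsometricRep U) (v : H) : HasCauchyAvg (fun g => U g v) := by
  intro ε hε
  set K := convexHull ℝ (Set.range fun g => U g v) with hK
  have hne : ((fun c => ‖c‖) '' K).Nonempty :=
    ⟨_, _, subset_convexHull ℝ _ ⟨0, rfl⟩, rfl⟩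
  set d := sInf ((fun c => ‖c‖) '' K) with hd
  have hbdd : BddBelow ((fun c => ‖c‖) '' K) := ⟨0, by rintro _ ⟨c, -, rfl⟩; positivity⟩
  have hd0 : 0 ≤ d := le_csInf hne (by rintro _ ⟨c, -, rfl⟩; positivity)
  have hdle : ∀ c ∈ K, d ≤ ‖c‖ := fun c hc => csInf_le hbdd ⟨c, hc, rfl⟩
  -- `δ` is chosen so that `(2 * (d + 2 * δ)) ^ 2 - (2 * d) ^ 2 = 16 * δ * (d + δ) ≤ ε ^ 2`
  set δ := min 1 (ε ^ 2 / (16 * (d + 1))) with hδ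
  have hδ0 : 0 < δ := by positivity
  have hδ1 : δ ≤ 1 := min_le_left _ _
  have hδ2 : δ * (16 * (d + 1)) ≤ ε ^ 2 := by
    rw [← le_div_iff₀ (by positivity)]; exact min_le_right _ _
  obtain ⟨_, ⟨c, hc, rfl⟩, hcd⟩ := exists_lt_of_csInf_lt hne (show d < d + δ by linarith)
  refine ⟨_, (Metric.tendsto_nhds.1 (hU.tendsto_avg_sub_of_mem_convexHull hc) δ hδ0).and
    eventually_nonempty_folnerFilter, ?_⟩
  have key : ∀ F : Finset G, dist (avg F (fun g => U g c) - avg F (fun g => U g v)) 0 < δ →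
      ‖avg F (fun g => U g v)‖ ≤ d + 2 * δ := by
    intro F hF
    rw [dist_zero_right, norm_sub_rev] at hF
    have h1 : ‖avg F (fun g => U g c)‖ ≤ ‖c‖ := norm_avg_le (by positivity) fun g _ => by simp
    have h2 := norm_le_norm_add_norm_sub' (avg F (fun g => U g v)) (avg F (fun g => U g c))
    dsimp only at hcd
    linarith
  rintro F ⟨hF, hFn⟩ F' ⟨hF', hFn'⟩
  have k1 := key F hF
  have k2 := key F' hF'
  set x := avg F (fun g => U g v)
  set y := avg F' (fun g => U g v)
  have hm : (1 / 2 : ℝ) • x + (1 / 2 : ℝ) • y ∈ K :=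
    convex_convexHull ℝ _ (avg_mem_convexHull v hFn) (avg_mem_convexHull v hFn')
      (by norm_num) (by norm_num) (by norm_num)
  have hxy : 2 * d ≤ ‖x + y‖ := by
    have := hdle _ hm
    rw [← smul_add, norm_smul, Real.norm_of_nonneg (by norm_num)] at this
    linarith
  have hpar := parallelogram_law_with_norm ℝ x y
  refine abs_le_of_sq_le_sq' ?_ hε.le |>.2
  nlinarith [norm_nonneg x, norm_nonneg y, norm_nonneg (x + y)]

lemma hasCauchyAvg_inner_mul_inner (hU : IsIsometricRep U) (hV : IsIsometricRep V)
    (a b : H) (c d : H') :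
    HasCauchyAvg (fun g => inner ℝ a (U g b) * inner ℝ c (V g d)) := by
  intro ε hε
  set τ := a ⊗ₜ[ℝ] c
  obtain ⟨S, hS, h⟩ := (hU.tensor hV).hasCauchyAvg (b ⊗ₜ[ℝ] d) (ε / (‖τ‖ + 1)) (by positivity)
  refine ⟨S, hS, fun F hF F' hF' => ?_⟩
  have h1 : ∀ F : Finset G, avg F (fun g => inner ℝ a (U g b) * inner ℝ c (V g d)) =
      inner ℝ τ (avg F fun g => TensorProduct.mapIsometry (U g) (V g) (b ⊗ₜ[ℝ] d)) := by
    intro F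
    have := map_avg (innerSL ℝ τ) F (fun g => TensorProduct.mapIsometry (U g) (V g) (b ⊗ₜ[ℝ] d))
    simp only [innerSL_apply_apply] at this
    rw [this]
    simp [τ]
  rw [h1, h1, Real.norm_eq_abs]
  refine (abs_inner_sub_inner_le (H := H ⊗[ℝ] H') _ _ _).trans ?_
  have := h F hF F' hF'
  rw [le_div_iff₀ (by positivity)] at this
  nlinarith [norm_nonneg τ, norm_nonneg ((avg F fun g =>
    TensorProduct.mapIsometry (U g) (V g) (b ⊗ₜ[ℝ] d)) - avg F' fun g =>
    TensorProduct.mapIsometry (U g) (V g) (b ⊗ₜ[ℝ] d))]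

end IsIsometricRep

/-- The almost periodic vectors of `U`: the vectors whose orbit is, for every `ε`, contained in the
`ε`-neighbourhood of a finite-dimensional subspace. As orbits are bounded, these are the vectors
with precompact orbit. -/
def almostPeriodic (U : G → H →ₗᵢ[ℝ] H) : Submodule ℝ H where
  carrier := {f | ∀ ε > 0, ∃ W : Submodule ℝ H, FiniteDimensional ℝ W ∧
    ∀ g, ∃ w ∈ W, ‖U g f - w‖ ≤ ε}
  zero_mem' := fun ε hε => ⟨⊥, inferInstance, fun g => ⟨0, by simp, by simpa using hε.le⟩⟩
  add_mem' := by
    intro a b ha hb ε hε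
    obtain ⟨W, hW, h⟩ := ha (ε / 2) (by positivity)
    obtain ⟨W', hW', h'⟩ := hb (ε / 2) (by positivity)
    refine ⟨W ⊔ W', inferInstance, fun g => ?_⟩
    obtain ⟨w, hw, h1⟩ := h g
    obtain ⟨w', hw', h2⟩ := h' g
    refine ⟨w + w', Submodule.add_mem_sup hw hw', ?_⟩
    rw [map_add, add_sub_add_comm]
    linarith [norm_add_le (U g a - w) (U g b - w')]
  smul_mem' := by
    intro c a ha ε hε
    obtain ⟨W, hW, h⟩ := ha (ε / (|c| + 1)) (by positivity)
    refine ⟨W, hW, fun g => ?_⟩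
    obtain ⟨w, hw, h1⟩ := h g
    refine ⟨c • w, W.smul_mem c hw, ?_⟩
    rw [map_smul, ← smul_sub, norm_smul, Real.norm_eq_abs]
    rw [le_div_iff₀ (by positivity)] at h1
    nlinarith [norm_nonneg (U g a - w)]

omit [AddCommGroup G] in
lemma isClosed_almostPeriodic (U : G → H →ₗᵢ[ℝ] H) :
    IsClosed (almostPeriodic U : Set H) := by
  refine isClosed_of_closure_subset fun x hx ε hε => ?_
  obtain ⟨y, hy, hxy⟩ := Metric.mem_closure_iff.1 hx (ε / 2) (by positivity)
  obtain ⟨W, hW, h⟩ := hy (ε / 2) (by positivity)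
  refine ⟨W, hW, fun g => ?_⟩
  obtain ⟨w, hw, h1⟩ := h g
  refine ⟨w, hw, ?_⟩
  have h2 : ‖U g x - U g y‖ < ε / 2 := by rwa [← map_sub, (U g).norm_map, ← dist_eq_norm]
  linarith [norm_sub_le_norm_sub_add_norm_sub (U g x) (U g y) w]

/-- If one of the two orbits is almost periodic, then the correlations of the two orbits, twisted
by any bounded operator, have Cauchy averages: the almost periodic orbit may be projected to a
finite-dimensional space, and there one has finitely many products of matrix coefficients. -/
theorem hasCauchyAvg_inner_of_mem_almostPeriodic {U : G → H →ₗᵢ[ℝ] H} {V : G → H' →ₗᵢ[ℝ] H'}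
    [CompleteSpace H] [CompleteSpace H']
    (hU : IsIsometricRep U) (hV : IsIsometricRep V) (M : H' →L[ℝ] H) {f : H}
    (hf : f ∈ almostPeriodic U) (x : H') :
    HasCauchyAvg (fun g => inner ℝ (U g f) (M (V g x))) := by
  refine HasCauchyAvg.of_approx fun ε hε => ?_
  obtain ⟨W, hW, h⟩ := hf (ε / (‖M‖ * ‖x‖ + 1)) (by positivity)
  let b := stdOrthonormalBasis ℝ W
  refine ⟨fun g => ∑ i, inner ℝ (b i : H) (U g f) * inner ℝ (M.adjoint (b i : H)) (V g x),
    HasCauchyAvg.sum _ fun i _ => hU.hasCauchyAvg_inner_mul_inner hV _ _ _ _, fun g => ?_⟩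
  have h1 : ∑ i, inner ℝ (b i : H) (U g f) * inner ℝ (M.adjoint (b i : H)) (V g x) =
      inner ℝ (W.starProjection (U g f)) (M (V g x)) := by
    rw [W.starProjection_apply, b.orthogonalProjectionOnto_apply_eq_sum]
    simp only [Submodule.coe_sum, Submodule.coe_smul, sum_inner, real_inner_smul_left,
      ContinuousLinearMap.adjoint_inner_left]
  beta_reduce
  rw [h1, ← inner_sub_left]
  obtain ⟨w, hw, h2⟩ := h g
  have h3 : ‖U g f - W.starProjection (U g f)‖ ≤ ε / (‖M‖ * ‖x‖ + 1) := by
    refine le_trans ?_ h2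
    rw [W.starProjection_minimal]
    exact ciInf_le ⟨0, by rintro _ ⟨y, rfl⟩; exact norm_nonneg _⟩ (⟨w, hw⟩ : W)
  have h4 : ‖M (V g x)‖ ≤ ‖M‖ * ‖x‖ := by simpa using M.le_opNorm (V g x)
  refine (norm_inner_le_norm _ _).trans ?_
  calc _ ≤ ε / (‖M‖ * ‖x‖ + 1) * (‖M‖ * ‖x‖) := by gcongr
    _ ≤ ε := by
      rw [div_mul_eq_mul_div, div_le_iff₀ (by positivity)]
      nlinarith [mul_nonneg (norm_nonneg M) (norm_nonneg x)]

/-- The average over `h ∈ F` of the rank one operators `x ↦ ⟪U h f, x⟫ U h f`. -/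
def orbitOperator (U : G → H →ₗᵢ[ℝ] H) (f : H) (F : Finset G) : H →L[ℝ] H :=
  avg F (fun h => (innerSL ℝ (U h f)).smulRight (U h f))

omit [AddCommGroup G] in
lemma orbitOperator_apply (U : G → H →ₗᵢ[ℝ] H) (f : H) (F : Finset G) (x : H) :
    orbitOperator U f F x = avg F (fun h => inner ℝ (U h f) x • U h f) := by
  have := map_avg (ContinuousLinearMap.apply ℝ H x) F
    (fun h => (innerSL ℝ (U h f)).smulRight (U h f))
  simpa [orbitOperator] using this

omit [AddCommGroup G] in
lemma inner_orbitOperator (U : G → H →ₗᵢ[ℝ] H) (f : H) (F : Finset G) (x y : H) :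
    inner ℝ (orbitOperator U f F x) y = avg F (fun h => inner ℝ (U h f) x * inner ℝ (U h f) y) := by
  rw [orbitOperator_apply, real_inner_comm]
  have := map_avg (innerSL ℝ y) F (fun h => inner ℝ (U h f) x • U h f)
  simp only [innerSL_apply_apply, real_inner_smul_right] at this
  rw [this]
  simp only [real_inner_comm y]

variable {U : G → H →ₗᵢ[ℝ] H}

/-- The operator norm is bounded by the Hilbert–Schmidt norm, that is by the norm in the tensor
square, where the mean ergodic theorem applies. -/
lemma IsIsometricRep.hasCauchyAvg_orbitOperator (hU : IsIsometricRep U) (f : H) :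
    HasCauchyAvg (fun h => (innerSL ℝ (U h f)).smulRight (U h f)) := by
  intro ε hε
  obtain ⟨S, hS, h⟩ := (hU.tensor hU).hasCauchyAvg (f ⊗ₜ[ℝ] f) ε hε
  refine ⟨S, hS, fun F hF F' hF' => ?_⟩
  refine le_trans ?_ (h F hF F' hF')
  set t : Finset G → H ⊗[ℝ] H := fun F =>
    avg F (fun g => TensorProduct.mapIsometry (U g) (U g) (f ⊗ₜ[ℝ] f))
  change ‖orbitOperator U f F - orbitOperator U f F'‖ ≤ ‖t F - t F'‖
  have h1 : ∀ (F : Finset G) (x y : H),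
      inner ℝ (orbitOperator U f F x) y = inner ℝ (x ⊗ₜ[ℝ] y) (t F) := by
    intro F x y
    have := map_avg (innerSL ℝ (x ⊗ₜ[ℝ] y)) F
      (fun g => TensorProduct.mapIsometry (U g) (U g) (f ⊗ₜ[ℝ] f))
    simp only [innerSL_apply_apply] at this
    rw [inner_orbitOperator, this]
    simp [real_inner_comm]
  refine ContinuousLinearMap.opNorm_le_bound _ (norm_nonneg _) fun x => ?_
  set z := (orbitOperator U f F - orbitOperator U f F') x with hz
  have h2 : ‖z‖ * ‖z‖ ≤ ‖t F - t F'‖ * ‖x‖ * ‖z‖ := by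
    rw [← real_inner_self_eq_norm_mul_norm]
    nth_rewrite 1 [hz]
    rw [sub_apply, inner_sub_left, h1, h1]
    refine (le_abs_self _).trans ((abs_inner_sub_inner_le (H := H ⊗[ℝ] H) _ _ _).trans_eq ?_)
    rw [TensorProduct.norm_tmul]; ring
  rcases (norm_nonneg z).eq_or_lt with h0 | h0
  · rw [← h0]; positivity
  · exact le_of_mul_le_mul_right h2 h0

/-- A vector orthogonal to all almost periodic vectors is weakly mixing: its orbit operators tend
to zero in norm. Indeed their limit commutes with `U` and is a limit of finite rank operators, so
its range consists of almost periodic vectors; but it is also orthogonal to these. -/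
theorem IsIsometricRep.tendsto_orbitOperator [CompleteSpace H] (hU : IsIsometricRep U) {f : H}
    (hf : f ∈ (almostPeriodic U)ᗮ) :
    Tendsto (orbitOperator U f) (folnerFilter G) (𝓝 0) := by
  rcases (folnerFilter G).eq_or_neBot with hbot | hbot
  · simp [hbot]
  obtain ⟨S, hS⟩ := (hU.hasCauchyAvg_orbitOperator f).exists_tendsto
  change Tendsto (orbitOperator U f) (folnerFilter G) (𝓝 S) at hS
  have happ : ∀ x, Tendsto (fun F => orbitOperator U f F x) (folnerFilter G) (𝓝 (S x)) :=
    fun x => ((ContinuousLinearMap.apply ℝ H x).continuous.tendsto S).comp hS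
  -- conjugating by `U g` translates the averages, which does not affect the limit
  have hcomm : ∀ g x, U g (S x) = S (U g x) := by
    intro g x
    have h1 : Tendsto (fun F => U g (orbitOperator U f F x)) (folnerFilter G) (𝓝 (U g (S x))) :=
      ((U g).continuous.tendsto _).comp (happ x)
    have h2 := tendsto_avg_shift_sub (u := fun h => inner ℝ (U h f) (U g x) • U h f)
      (C := ‖f‖ * ‖x‖ * ‖f‖) (fun h => by
        rw [norm_smul, (U h).norm_map]
        gcongr
        simpa using norm_inner_le_norm (𝕜 := ℝ) (U h f) (U g x)) g
    have h3 := (happ (U g x)).add h2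
    rw [add_zero] at h3
    refine tendsto_nhds_unique h1 (h3.congr fun F => ?_)
    rw [orbitOperator_apply, add_sub_cancel, orbitOperator_apply]
    have := map_avg (U g).toContinuousLinearMap F (fun h => inner ℝ (U h f) x • U h f)
    simp only [LinearIsometry.coe_toContinuousLinearMap, map_smul] at this
    rw [this]
    simp only [hU.add_apply, (U g).inner_map_map]
  have hAP : ∀ x, S x ∈ almostPeriodic U := by
    intro x ε hε
    obtain ⟨F, hF⟩ := (Metric.tendsto_nhds.1 hS (ε / (‖x‖ + 1)) (by positivity)).exists
    refine ⟨Submodule.span ℝ ((fun h => U h f) '' (F : Set G)),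
      FiniteDimensional.span_of_finite ℝ (F.finite_toSet.image _), fun g =>
      ⟨orbitOperator U f F (U g x), ?_, ?_⟩⟩
    · rw [orbitOperator_apply]
      exact Submodule.smul_mem _ _ (Submodule.sum_mem _ fun h hh =>
        Submodule.smul_mem _ _ (Submodule.subset_span ⟨h, hh, rfl⟩))
    · rw [hcomm, ← sub_apply]
      refine (ContinuousLinearMap.le_opNorm _ _).trans ?_
      rw [(U g).norm_map]
      rw [dist_comm, dist_eq_norm, lt_div_iff₀ (by positivity)] at hF
      nlinarith [norm_nonneg (S - orbitOperator U f F)]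
  have horth : ∀ h, U h f ∈ (almostPeriodic U)ᗮ := by
    intro h k hk
    rw [real_inner_comm, hU.inner_eq, real_inner_comm]
    refine hf _ fun ε hε => ?_
    obtain ⟨W, hW, hw⟩ := hk ε hε
    exact ⟨W, hW, fun g => by rw [← hU.add_apply]; exact hw _⟩
  have hperp : ∀ x, S x ∈ (almostPeriodic U)ᗮ := by
    intro x
    refine (Submodule.isClosed_orthogonal _).mem_of_tendsto (happ x) (Eventually.of_forall ?_)
    intro F
    rw [orbitOperator_apply]
    exact Submodule.smul_mem _ _ (Submodule.sum_mem _ fun h _ => Submodule.smul_mem _ _ (horth h))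
  have hS0 : S = 0 := by
    ext x
    exact inner_self_eq_zero.1 (hperp x _ (hAP x))
  rwa [hS0] at hS

/-- Van der Corput's lemma: a bounded family `u` averages to zero as soon as its correlations
`g ↦ ⟪u (h + g), u (h' + g)⟫` have averages asymptotically at most `B h h'`, with a kernel `B` whose
averages over some finite squares `E × E` are arbitrarily small. -/
theorem tendsto_avg_of_van_der_corput {u : G → H} {C : ℝ} (hu : ∀ g, ‖u g‖ ≤ C)
    (B : G → G → ℝ)
    (hB : ∀ h h', ∀ ε > 0, ∀ᶠ F in folnerFilter G,
      avg F (fun g => inner ℝ (u (h + g)) (u (h' + g))) ≤ B h h' + ε)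
    (hsmall : ∀ ε > 0, ∃ E : Finset G, E.Nonempty ∧ avg E (fun h => avg E (B h)) ≤ ε) :
    Tendsto (fun F => avg F u) (folnerFilter G) (𝓝 0) := by
  rw [Metric.tendsto_nhds]
  intro ε hε
  obtain ⟨E, hE, hEB⟩ := hsmall (ε ^ 2 / 16) (by positivity)
  -- averaging over `F` hardly changes when `u` is first averaged over its translates by `E`
  have h1 : Tendsto (fun F => avg E (fun h => avg F (fun g => u (h + g)) - avg F u))
      (folnerFilter G) (𝓝 0) := by
    have := tendsto_finsetSum E (fun h _ => tendsto_avg_shift_sub hu h)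
    simpa [avg] using this.const_smul (E.card : ℝ)⁻¹
  have h2 : ∀ᶠ F in folnerFilter G, ∀ h ∈ E, ∀ h' ∈ E,
      avg F (fun g => inner ℝ (u (h + g)) (u (h' + g))) ≤ B h h' + ε ^ 2 / 16 := by
    refine (Finset.eventually_all E).2 fun h _ => (Finset.eventually_all E).2 fun h' _ => ?_
    exact hB h h' _ (by positivity)
  filter_upwards [Metric.tendsto_nhds.1 h1 (ε / 2) (by positivity), h2] with F hF1 hF2
  rw [dist_zero_right] at hF1 ⊢
  set y := avg F (fun g => avg E (fun h => u (h + g))) with hy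
  have e1 : avg E (fun h => avg F (fun g => u (h + g)) - avg F u) = y - avg F u := by
    rw [avg_sub, avg_const hE, hy, avg_comm]
  have e2 : ‖y‖ ^ 2 ≤ ε ^ 2 / 8 := by
    calc ‖y‖ ^ 2 ≤ avg F (fun g => ‖avg E (fun h => u (h + g))‖ ^ 2) := norm_avg_sq_le _ _
      _ = avg F (fun g => avg E (fun h => avg E (fun h' => inner ℝ (u (h + g)) (u (h' + g))))) := by
        congr 1; ext g
        rw [← real_inner_self_eq_norm_sq]
        have := map_avg (innerSL ℝ (avg E (fun h => u (h + g)))) E (fun h => u (h + g))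
        simp only [innerSL_apply_apply] at this
        rw [this]
        congr 1; ext h
        rw [real_inner_comm]
        have := map_avg (innerSL ℝ (u (h + g))) E (fun h => u (h + g))
        simpa only [innerSL_apply_apply] using this
      _ = avg E (fun h => avg E (fun h' => avg F (fun g => inner ℝ (u (h + g)) (u (h' + g))))) := by
        rw [avg_comm]
        congr 1; ext h
        rw [avg_comm]
      _ ≤ avg E (fun h => avg E (fun h' => B h h' + ε ^ 2 / 16)) :=
        avg_mono fun h hh => avg_mono fun h' hh' => hF2 h hh h' hh'
      _ = avg E (fun h => avg E (B h)) + ε ^ 2 / 16 := by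
        simp only [avg_add, avg_const hE]
      _ ≤ ε ^ 2 / 8 := by linarith
  have e3 : ‖y‖ < ε / 2 := by
    refine lt_of_pow_lt_pow_left₀ 2 (by positivity) ?_
    have := sq_pos_of_pos hε
    linarith [show (ε / 2) ^ 2 = ε ^ 2 / 4 by ring]
  rw [e1] at hF1
  have := norm_sub_le_norm_sub_add_norm_sub (avg F u) y 0
  rw [sub_zero, sub_zero, norm_sub_rev] at this
  linarith

end IsometricRepresentations

/-! ### Functions invariant under a subgroup of finite index -/

noncomputable section FiniteIndex

variable {G X : Type*} [AddCommGroup G] [MeasurableSpace X] [AddAction G X]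
  [MeasurableConstVAdd G X] {μ : Measure X}

/-- The measurable sets of positive measure that are invariant modulo `μ` under `K`. -/
def invariantSets (K : AddSubgroup G) (μ : Measure X) : Set (Set X) :=
  {B | MeasurableSet B ∧ (∀ h ∈ K, (h +ᵥ ·) ⁻¹' B =ᵐ[μ] B) ∧ μ B ≠ 0}

/-- The translates of a `K`-invariant set of positive measure by coset representatives cover the
space, since their union is `G`-invariant. -/
lemma ae_exists_mem_of_mem_invariantSets [ErgodicVAdd G X μ] (K : AddSubgroup G) [K.FiniteIndex]
    {B : Set X} (hB : B ∈ invariantSets K μ) :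
    ∀ᵐ x ∂μ, ∃ q : G ⧸ K, q.out +ᵥ x ∈ B := by
  obtain ⟨hBm, hBinv, hB0⟩ := hB
  set Y : Set X := ⋃ q : G ⧸ K, (q.out +ᵥ ·) ⁻¹' B with hY
  have hYm : MeasurableSet Y := MeasurableSet.iUnion fun q => measurable_const_vadd _ hBm
  have hYinv : ∀ g : G, (g +ᵥ ·) ⁻¹' Y =ᵐ[μ] Y := by
    intro g
    have h1 : (g +ᵥ ·) ⁻¹' Y = ⋃ q : G ⧸ K, (fun x => q.out +ᵥ (g +ᵥ x)) ⁻¹' B := by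
      simp [hY, Set.preimage_iUnion, Set.preimage_preimage]
    have h2 : Y = ⋃ q : G ⧸ K, ((q + (g : G ⧸ K)).out +ᵥ ·) ⁻¹' B := by
      rw [hY]
      exact ((Equiv.addRight (g : G ⧸ K)).surjective.iUnion_comp
        (fun q : G ⧸ K => (q.out +ᵥ ·) ⁻¹' B)).symm
    rw [h1, h2]
    refine Filter.EventuallyEq.countable_iUnion fun q => ?_
    set r := (q + (g : G ⧸ K)).out with hr
    have hmem : q.out + g - r ∈ K := by
      rw [← QuotientAddGroup.eq_zero_iff, QuotientAddGroup.mk_sub, QuotientAddGroup.mk_add, hr]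
      simp
    have h3 : (fun x : X => q.out +ᵥ (g +ᵥ x)) ⁻¹' B =
        (r +ᵥ ·) ⁻¹' (((q.out + g - r) +ᵥ ·) ⁻¹' B) := by
      ext x
      simp [vadd_vadd]
    rw [h3]
    exact (measurePreserving_vadd r μ).quasiMeasurePreserving.preimage_ae_eq (hBinv _ hmem)
  have hYpos : ¬ ∀ᵐ x ∂μ, x ∉ Y := by
    intro h
    have h0 : μ Y = 0 := by simpa [ae_iff] using h
    have h1 : μ ((((0 : G ⧸ K).out : G) +ᵥ ·) ⁻¹' B) = 0 :=
      measure_mono_null (Set.subset_iUnion (fun q : G ⧸ K => (q.out +ᵥ ·) ⁻¹' B) 0) h0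
    rw [(measurePreserving_vadd _ μ).measure_preimage hBm.nullMeasurableSet] at h1
    exact hB0 h1
  have := (eventuallyConst_set.1
    (ErgodicVAdd.aeconst_of_forall_preimage_vadd_ae_eq (G := G) hYm hYinv)).resolve_right hYpos
  filter_upwards [this] with x hx
  simpa [hY] using hx

/-- An invariant set of positive measure that is minimal: its measure is less than twice the
infimum of the measures of such sets, so it cannot be split into two of them. -/
lemma exists_atom_invariantSets [IsProbabilityMeasure μ] [ErgodicVAdd G X μ] (K : AddSubgroup G)
    [K.FiniteIndex] :
    ∃ B ∈ invariantSets K μ, ∀ C, MeasurableSet C → (∀ h ∈ K, (h +ᵥ ·) ⁻¹' C =ᵐ[μ] C) →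
      μ (B ∩ C) = 0 ∨ μ (B \ C) = 0 := by
  have hfin : Fintype (G ⧸ K) := Fintype.ofFinite _
  set S := μ.real '' invariantSets K μ with hS
  have hne : S.Nonempty := ⟨_, Set.univ, ⟨MeasurableSet.univ, by simp, by simp⟩, rfl⟩
  have hcard : (0 : ℝ) < Fintype.card (G ⧸ K) := by exact_mod_cast Fintype.card_pos
  -- finitely many translates of such a set cover the space, so its measure is bounded below
  have hlow : ∀ s ∈ S, ((Fintype.card (G ⧸ K) : ℝ))⁻¹ ≤ s := by
    rintro _ ⟨B, hB, rfl⟩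
    have hcov := ae_exists_mem_of_mem_invariantSets K hB
    have h1 : (1 : ℝ) ≤ ∑ q : G ⧸ K, μ.real ((q.out +ᵥ ·) ⁻¹' B) := by
      rw [← probReal_univ (μ := μ)]
      refine le_trans (le_of_eq ?_)
        (measureReal_iUnion_fintype_le (fun q : G ⧸ K => (q.out +ᵥ ·) ⁻¹' B))
      refine measureReal_congr (EventuallyEq.symm (eventuallyEq_univ.2 ?_))
      filter_upwards [hcov] with x hx
      exact Set.mem_iUnion.2 hx
    have h2 : ∀ q : G ⧸ K, μ.real ((q.out +ᵥ ·) ⁻¹' B) = μ.real B := fun q =>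
      (measurePreserving_vadd _ μ).measureReal_preimage hB.1.nullMeasurableSet
    simp only [h2, Finset.sum_const, Finset.card_univ, nsmul_eq_mul] at h1
    rwa [inv_le_iff_one_le_mul₀' hcard]
  set s := sInf S
  have hs0 : 0 < s := (inv_pos.2 hcard).trans_le (le_csInf hne hlow)
  have hsle : ∀ B ∈ invariantSets K μ, s ≤ μ.real B := fun B hB =>
    csInf_le ⟨_, hlow⟩ ⟨B, hB, rfl⟩
  obtain ⟨_, ⟨B, hB, rfl⟩, hBs⟩ := exists_lt_of_csInf_lt hne (show s < 2 * s by linarith)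
  refine ⟨B, hB, fun C hC hCinv => ?_⟩
  by_contra! hcon
  have h1 := hsle (B ∩ C) ⟨hB.1.inter hC, fun h hh => (hB.2.1 h hh).inter (hCinv h hh), hcon.1⟩
  have h2 := hsle (B \ C) ⟨hB.1.diff hC, fun h hh => (hB.2.1 h hh).diff (hCinv h hh), hcon.2⟩
  have h3 := measureReal_inter_add_sdiff (μ := μ) (s := B) hC
  linarith

/-- For an ergodic action and a subgroup `K` of finite index there is a finite measurable partition
of unity such that every `K`-invariant function is constant on the support of each of its members:
the normalized indicators of the translates of an atom of the `K`-invariant sets. -/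
theorem exists_partition_of_finiteIndex [IsProbabilityMeasure μ] [ErgodicVAdd G X μ]
    (K : AddSubgroup G) [K.FiniteIndex] [Fintype (G ⧸ K)] :
    ∃ w : G ⧸ K → X → ℝ, (∀ q, Measurable (w q)) ∧ (∀ q x, 0 ≤ w q x) ∧ (∀ q x, w q x ≤ 1) ∧
      (∀ᵐ x ∂μ, ∑ q, w q x = 1) ∧
      ∀ v : X → ℝ, Measurable v → (∀ h ∈ K, ∀ᵐ x ∂μ, v (h +ᵥ x) = v x) →
        ∀ q, ∃ c, ∀ᵐ x ∂μ, v x * w q x = c * w q x := by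
  obtain ⟨B, hB, hatom⟩ := exists_atom_invariantSets (μ := μ) K
  set b : G ⧸ K → X → ℝ := fun q => ((q.out +ᵥ ·) ⁻¹' B).indicator (fun _ => (1 : ℝ)) with hb
  have hbm : ∀ q, Measurable (b q) := fun q =>
    measurable_const.indicator (measurable_const_vadd _ hB.1)
  have hb0 : ∀ q x, 0 ≤ b q x := fun q x => Set.indicator_nonneg (fun _ _ => zero_le_one) x
  refine ⟨fun q x => b q x / ∑ p, b p x,
    fun q => (hbm q).div (Finset.measurable_sum _ fun p _ => hbm p),
    fun q x => div_nonneg (hb0 q x) (Finset.sum_nonneg fun p _ => hb0 p x),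
    fun q x => div_le_one_of_le₀
      (Finset.single_le_sum (f := fun p => b p x) (fun p _ => hb0 p x) (Finset.mem_univ q))
      (Finset.sum_nonneg fun p _ => hb0 p x), ?_, ?_⟩
  · filter_upwards [ae_exists_mem_of_mem_invariantSets K hB] with x ⟨q, hq⟩
    rw [← Finset.sum_div]
    refine div_self (ne_of_gt ?_)
    refine Finset.sum_pos' (fun p _ => hb0 p x) ⟨q, Finset.mem_univ q, ?_⟩
    have : x ∈ (q.out +ᵥ ·) ⁻¹' B := hq
    simp [hb, Set.indicator_of_mem this]
  · intro v hv hvinv q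
    -- On the translate of the atom by `q.out`, use the translate of `v` by `-q.out` on the atom.
    set r : G := q.out
    set v' : X → ℝ := fun x => v (-r +ᵥ x) with hv'
    have hv'm : Measurable v' := hv.comp (measurable_const_vadd _)
    have hv'inv : ∀ h ∈ K, ∀ᵐ x ∂μ, v' (h +ᵥ x) = v' x := by
      intro h hh
      have := (measurePreserving_vadd (-r) μ).quasiMeasurePreserving.ae (hvinv h hh)
      filter_upwards [this] with x hx
      simp only [hv', vadd_vadd] at hx ⊢
      rw [add_comm, hx]
    obtain ⟨c, hc⟩ : ∃ c, v' =ᵐ[μ.restrict B] Function.const X c := by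
      refine exists_eventuallyEq_const_of_forall_separating MeasurableSet fun U hU => ?_
      rcases hatom (v' ⁻¹' U) (hv'm hU) (fun h hh =>
        ((hv'inv h hh).mono fun x hx => by simp only [Set.mem_preimage, hx]).set_eq) with h0 | h0
      · right
        rw [ae_restrict_iff' hB.1, ae_iff]
        convert h0 using 2
        ext x; simp
      · left
        rw [ae_restrict_iff' hB.1, ae_iff]
        convert h0 using 2
        ext x; simp
    refine ⟨c, ?_⟩
    have hc' := (measurePreserving_vadd r μ).quasiMeasurePreserving.ae
      ((ae_restrict_iff' hB.1).1 hc)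
    filter_upwards [hc'] with x hx
    by_cases hxB : r +ᵥ x ∈ B
    · have h1 := hx hxB
      simp only [hv', vadd_vadd, neg_add_cancel, zero_vadd, Function.const] at h1
      rw [h1]
    · have : b q x = 0 := Set.indicator_of_notMem (s := (r +ᵥ ·) ⁻¹' B) hxB _
      simp [this]

end FiniteIndex

/-! ### Koopman operators and multiplication operators -/

noncomputable section Koopman

open scoped ENNReal

variable {G X : Type*} [AddCommGroup G] [MeasurableSpace X] [AddAction G X]
  [MeasurableConstVAdd G X] {μ : Measure X}

lemma inner_Lp_eq_integral (f g : Lp ℝ 2 μ) : inner ℝ f g = ∫ x, f x * g x ∂μ := by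
  simp [L2.inner_def, mul_comm]

variable (μ) in
/-- The Koopman operator `f ↦ f ∘ T_g` on `L²`. -/
def koopman [VAddInvariantMeasure G X μ] (g : G) : Lp ℝ 2 μ →ₗᵢ[ℝ] Lp ℝ 2 μ :=
  Lp.compMeasurePreservingₗᵢ ℝ (g +ᵥ ·) (measurePreserving_vadd g μ)

lemma coeFn_koopman [VAddInvariantMeasure G X μ] (g : G) (f : Lp ℝ 2 μ) :
    koopman μ g f =ᵐ[μ] fun x => f (g +ᵥ x) :=
  Lp.coeFn_compMeasurePreserving f (measurePreserving_vadd g μ)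

lemma isIsometricRep_koopman [VAddInvariantMeasure G X μ] :
    IsIsometricRep (koopman μ : G → Lp ℝ 2 μ →ₗᵢ[ℝ] Lp ℝ 2 μ) := by
  constructor
  · intro f
    refine Lp.ext ?_
    filter_upwards [coeFn_koopman (0 : G) f] with x hx
    rw [hx, zero_vadd]
  · intro g h f
    refine Lp.ext ?_
    filter_upwards [coeFn_koopman (g + h) f, coeFn_koopman g (koopman μ h f),
      (measurePreserving_vadd g μ).quasiMeasurePreserving.ae (coeFn_koopman h f)] with x h1 h2 h3
    rw [h1, h2, h3, vadd_vadd, add_comm]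

/-- Measurable functions bounded by one in absolute value. -/
structure IsUnitBounded (φ : X → ℝ) : Prop where
  measurable : Measurable φ
  abs_le : ∀ x, |φ x| ≤ 1

namespace IsUnitBounded

variable {φ ψ : X → ℝ}

lemma mul (hφ : IsUnitBounded φ) (hψ : IsUnitBounded ψ) : IsUnitBounded (fun x => φ x * ψ x) :=
  ⟨hφ.measurable.mul hψ.measurable, fun x => by
    rw [abs_mul]; exact mul_le_one₀ (hφ.abs_le x) (abs_nonneg _) (hψ.abs_le x)⟩

lemma vadd (hφ : IsUnitBounded φ) (g : G) : IsUnitBounded (fun x => φ (g +ᵥ x)) :=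
  ⟨hφ.measurable.comp (measurable_const_vadd g), fun _ => hφ.abs_le _⟩

lemma memLp [IsFiniteMeasure μ] (hφ : IsUnitBounded φ) (p : ℝ≥0∞) : MemLp φ p μ :=
  MemLp.of_bound hφ.measurable.aestronglyMeasurable 1 (Eventually.of_forall hφ.abs_le)

lemma integrable_mul (hφ : IsUnitBounded φ) {f : X → ℝ} (hf : Integrable f μ) :
    Integrable (fun x => f x * φ x) μ :=
  hf.mul_bdd hφ.measurable.aestronglyMeasurable (Eventually.of_forall hφ.abs_le)

variable (μ) in
/-- The class of a bounded function in `L²`. -/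
def toL2 [IsFiniteMeasure μ] (hφ : IsUnitBounded φ) : Lp ℝ 2 μ := (hφ.memLp 2).toLp φ

lemma coeFn_toL2 [IsFiniteMeasure μ] (hφ : IsUnitBounded φ) : hφ.toL2 μ =ᵐ[μ] φ :=
  MemLp.coeFn_toLp _

variable (μ) in
/-- Multiplication by a bounded function, as an operator on `L²`. -/
def mulOp [IsFiniteMeasure μ] (hφ : IsUnitBounded φ) : Lp ℝ 2 μ →L[ℝ] Lp ℝ 2 μ :=
  (ContinuousLinearMap.mul ℝ ℝ).holderL μ ∞ 2 2 ((hφ.memLp ∞).toLp φ)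

lemma coeFn_mulOp [IsFiniteMeasure μ] (hφ : IsUnitBounded φ) (f : Lp ℝ 2 μ) :
    hφ.mulOp μ f =ᵐ[μ] fun x => φ x * f x := by
  filter_upwards [ContinuousLinearMap.coeFn_holder (r := 2) (ContinuousLinearMap.mul ℝ ℝ)
    ((hφ.memLp ∞).toLp φ) f, (hφ.memLp (μ := μ) ∞).coeFn_toLp] with x h1 h2
  rw [mulOp, ContinuousLinearMap.holderL_apply_apply, h1, h2]
  rfl

lemma norm_mulOp_le [IsFiniteMeasure μ] (hφ : IsUnitBounded φ) (f : Lp ℝ 2 μ) :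
    ‖hφ.mulOp μ f‖ ≤ ‖f‖ := by
  refine Lp.norm_le_norm_of_ae_le ?_
  filter_upwards [hφ.coeFn_mulOp f] with x hx
  rw [hx, norm_mul]
  exact mul_le_of_le_one_left (norm_nonneg _) (hφ.abs_le x)

lemma koopman_toL2 [IsFiniteMeasure μ] [VAddInvariantMeasure G X μ] (hφ : IsUnitBounded φ)
    (g : G) : koopman μ g (hφ.toL2 μ) = (hφ.vadd g).toL2 μ := rfl

end IsUnitBounded

end Koopman

/-! ### Correlations of an integrable function with the translates of a bounded function -/

noncomputable section Correlations

variable {G X : Type*} [AddCommGroup G] [MeasurableSpace X] [AddAction G X]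
  [MeasurableConstVAdd G X] {μ : Measure X} [IsProbabilityMeasure μ] [ErgodicVAdd G X μ]

/-- For `Φ` in `L²` the averages of `∫ Φ · T_{ψ g} Γ` converge to the pairing of `Φ` with a
`ψ(G)`-invariant function bounded by one, which is a combination of the functions `w q`. -/
lemma eventually_avg_integral_le_of_memLp (ψ : G →+ G) {ι : Type*} [Fintype ι] {w : ι → X → ℝ}
    (hw : ∀ q, IsUnitBounded (w q)) (hw0 : ∀ q x, 0 ≤ w q x) (hw1 : ∀ᵐ x ∂μ, ∑ q, w q x = 1)
    (hwv : ∀ v : X → ℝ, Measurable v → (∀ h ∈ ψ.range, ∀ᵐ x ∂μ, v (h +ᵥ x) = v x) →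
        ∀ q, ∃ c, ∀ᵐ x ∂μ, v x * w q x = c * w q x)
    {Γ : X → ℝ} (hΓ : IsUnitBounded Γ) {Φ : X → ℝ} (hΦ : MemLp Φ 2 μ) {ε : ℝ} (hε : 0 < ε) :
    ∀ᶠ F in folnerFilter G,
      avg F (fun g => ∫ x, Φ x * Γ (ψ g +ᵥ x) ∂μ) ≤ ∑ q, |∫ x, Φ x * w q x ∂μ| + ε := by
  rcases (folnerFilter G).eq_or_neBot with hbot | hbot
  · simp [hbot]
  have hΦi : Integrable Φ μ := hΦ.integrable (by norm_num)
  have hU := (isIsometricRep_koopman (G := G) (μ := μ)).comp ψ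
  obtain ⟨P, hP⟩ := (hU.hasCauchyAvg (hΓ.toL2 μ)).exists_tendsto
  have hinv : ∀ g, koopman μ (ψ g) P = P := by
    intro g
    have h1 := ((koopman μ (ψ g)).continuous.tendsto P).comp hP
    have h2 := tendsto_avg_shift_sub (u := fun h => koopman μ (ψ h) (hΓ.toL2 μ))
      (C := ‖hΓ.toL2 μ‖) (fun h => by simp) g
    have h3 := hP.add h2
    rw [add_zero] at h3
    refine tendsto_nhds_unique h1 (h3.congr fun F => ?_)
    have := map_avg (koopman μ (ψ g)).toContinuousLinearMap F
      (fun h => koopman μ (ψ h) (hΓ.toL2 μ))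
    simp only [LinearIsometry.coe_toContinuousLinearMap] at this
    simp only [add_sub_cancel, Function.comp, this, hU.add_apply]
  -- pairing with a fixed element of `L²`
  have hpair : ∀ Ψ : X → ℝ, MemLp Ψ 2 μ →
      Tendsto (fun F => avg F (fun g => ∫ x, Ψ x * Γ (ψ g +ᵥ x) ∂μ)) (folnerFilter G)
        (𝓝 (∫ x, Ψ x * P x ∂μ)) := by
    intro Ψ hΨ
    have h1 := ((innerSL ℝ (hΨ.toLp Ψ)).continuous.tendsto P).comp hP
    have h2 : innerSL ℝ (hΨ.toLp Ψ) P = ∫ x, Ψ x * P x ∂μ := by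
      rw [innerSL_apply_apply, inner_Lp_eq_integral]
      refine integral_congr_ae ?_
      filter_upwards [hΨ.coeFn_toLp] with x hx
      rw [hx]
    rw [h2] at h1
    refine h1.congr fun F => ?_
    simp only [Function.comp, map_avg]
    congr 1; ext g
    rw [innerSL_apply_apply, inner_Lp_eq_integral]
    refine integral_congr_ae ?_
    filter_upwards [hΨ.coeFn_toLp, (hΓ.vadd (ψ g)).coeFn_toL2 (μ := μ)] with x hx hx'
    rw [hx, IsUnitBounded.koopman_toL2, hx']
  choose c hc using hwv P (Lp.stronglyMeasurable P).measurable (by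
    rintro _ ⟨g, rfl⟩
    filter_upwards [coeFn_koopman (ψ g) P] with x hx
    rw [← hx, hinv])
  have hwi : ∀ q, Integrable (fun x => Φ x * w q x) μ := fun q => (hw q).integrable_mul hΦi
  have hlim : ∫ x, Φ x * P x ∂μ = ∑ q, c q * ∫ x, Φ x * w q x ∂μ := by
    simp only [← integral_const_mul]
    rw [← integral_finsetSum _ fun q _ => (hwi q).const_mul _]
    refine integral_congr_ae ?_
    filter_upwards [hw1, eventually_all.2 hc] with x h1 h2
    calc Φ x * P x = ∑ q, Φ x * (P x * w q x) := by
          rw [← Finset.mul_sum, ← Finset.mul_sum, h1, mul_one]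
      _ = _ := Finset.sum_congr rfl fun q _ => by rw [h2]; ring
  -- `|c q| ≤ 1` unless `w q` vanishes: pair the limit with `w q` itself
  have hcle : ∀ q, c q * ∫ x, Φ x * w q x ∂μ ≤ |∫ x, Φ x * w q x ∂μ| := by
    intro q
    set m := ∫ x, w q x ∂μ with hm
    have hm0 : 0 ≤ m := integral_nonneg (hw0 q)
    have hwint : Integrable (w q) μ := memLp_one_iff_integrable.1 ((hw q).memLp 1)
    rcases hm0.eq_or_lt with h0 | h0
    · have h1 : w q =ᵐ[μ] 0 := (integral_eq_zero_iff_of_nonneg (hw0 q) hwint).1 h0.symm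
      have h2 : ∫ x, Φ x * w q x ∂μ = 0 := by
        refine integral_eq_zero_of_ae ?_
        filter_upwards [h1] with x hx
        simp [hx]
      simp [h2]
    · have h1 : |c q * m| ≤ m := by
        have h2 : ∫ x, w q x * P x ∂μ = c q * m := by
          rw [hm, ← integral_const_mul]
          refine integral_congr_ae ?_
          filter_upwards [hc q] with x hx
          rw [mul_comm, hx]
        have h3 := (hpair (w q) ((hw q).memLp 2)).abs
        rw [h2] at h3
        refine le_of_tendsto h3 (Eventually.of_forall fun F => ?_)
        rw [← Real.norm_eq_abs]
        refine norm_avg_le hm0 fun g _ => ?_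
        refine (norm_integral_le_integral_norm _).trans ?_
        refine integral_mono_of_nonneg (Eventually.of_forall fun x => norm_nonneg _) hwint
          (Eventually.of_forall fun x => ?_)
        simp only [norm_mul, Real.norm_eq_abs, abs_of_nonneg (hw0 q x)]
        exact mul_le_of_le_one_right (hw0 q x) (hΓ.abs_le _)
      rw [abs_mul, abs_of_pos h0] at h1
      have h2 : |c q| ≤ 1 := by
        by_contra! hlt
        nlinarith
      refine (le_abs_self _).trans ?_
      rw [abs_mul]
      exact mul_le_of_le_one_left (abs_nonneg _) h2
  have hlt : ∫ x, Φ x * P x ∂μ < ∑ q, |∫ x, Φ x * w q x ∂μ| + ε := by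
    rw [hlim]
    have := Finset.sum_le_sum fun q (_ : q ∈ Finset.univ) => hcle q
    linarith
  exact ((hpair Φ hΦ).eventually_lt_const hlt).mono fun F hF => hF.le

/-- The same bound for integrable `Φ`, by approximation in `L¹`. -/
lemma eventually_avg_integral_le (ψ : G →+ G) {ι : Type*} [Fintype ι] {w : ι → X → ℝ}
    (hw : ∀ q, IsUnitBounded (w q)) (hw0 : ∀ q x, 0 ≤ w q x) (hw1 : ∀ᵐ x ∂μ, ∑ q, w q x = 1)
    (hwv : ∀ v : X → ℝ, Measurable v → (∀ h ∈ ψ.range, ∀ᵐ x ∂μ, v (h +ᵥ x) = v x) →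
        ∀ q, ∃ c, ∀ᵐ x ∂μ, v x * w q x = c * w q x)
    {Γ : X → ℝ} (hΓ : IsUnitBounded Γ) {Φ : X → ℝ} (hΦ : Integrable Φ μ) {ε : ℝ} (hε : 0 < ε) :
    ∀ᶠ F in folnerFilter G,
      avg F (fun g => ∫ x, Φ x * Γ (ψ g +ᵥ x) ∂μ) ≤ ∑ q, |∫ x, Φ x * w q x ∂μ| + ε := by
  obtain ⟨s, hs, -⟩ := (memLp_one_iff_integrable.2 hΦ).exists_simpleFunc_eLpNorm_sub_lt
    ENNReal.one_ne_top (ε := ENNReal.ofReal (ε / 3)) (by simpa using hε)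
  have hsi : Integrable s μ := s.integrable_of_isFiniteMeasure
  have hd : Integrable (fun x => Φ x - s x) μ := hΦ.sub hsi
  have hdε : ∫ x, |Φ x - s x| ∂μ ≤ ε / 3 := by
    have h1 : eLpNorm (Φ - ⇑s) 1 μ = ENNReal.ofReal (∫ x, ‖Φ x - s x‖ ∂μ) := by
      rw [eLpNorm_one_eq_lintegral_enorm, ofReal_integral_norm_eq_lintegral_enorm hd]
      rfl
    rw [h1, ENNReal.ofReal_lt_ofReal_iff (by positivity)] at hs
    exact hs.le
  have hdiff : ∀ θ : X → ℝ, IsUnitBounded θ →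
      |∫ x, Φ x * θ x ∂μ - ∫ x, s x * θ x ∂μ| ≤ ∫ x, |Φ x - s x| * |θ x| ∂μ := by
    intro θ hθ
    rw [← integral_sub (hθ.integrable_mul hΦ) (hθ.integrable_mul hsi)]
    refine (abs_integral_le_integral_abs).trans_eq ?_
    simp only [← sub_mul, abs_mul]
  have hdiff' : ∀ θ : X → ℝ, IsUnitBounded θ →
      |∫ x, Φ x * θ x ∂μ - ∫ x, s x * θ x ∂μ| ≤ ε / 3 := by
    intro θ hθ
    refine ((hdiff θ hθ).trans ?_).trans hdε
    refine integral_mono_of_nonneg (Eventually.of_forall fun x => by positivity) hd.abs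
      (Eventually.of_forall fun x => mul_le_of_le_one_right (abs_nonneg _) (hθ.abs_le x))
  have hsum : ∑ q, |∫ x, s x * w q x ∂μ| ≤ ∑ q, |∫ x, Φ x * w q x ∂μ| + ε / 3 := by
    have h1 : ∑ q, ∫ x, |Φ x - s x| * |w q x| ∂μ ≤ ε / 3 := by
      rw [← integral_finsetSum _ fun q _ => ?_]
      · refine le_trans (le_of_eq (integral_congr_ae ?_)) hdε
        filter_upwards [hw1] with x hx
        simp only [abs_of_nonneg (hw0 _ x), ← Finset.mul_sum, hx, mul_one]
      · exact ((hw q).integrable_mul hd).abs.congr (Eventually.of_forall fun x => abs_mul _ _)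
    have h2 : ∀ q, |∫ x, s x * w q x ∂μ| ≤
        |∫ x, Φ x * w q x ∂μ| + ∫ x, |Φ x - s x| * |w q x| ∂μ := by
      intro q
      have h3 := hdiff (w q) (hw q)
      have h4 := abs_sub_abs_le_abs_sub (∫ x, s x * w q x ∂μ) (∫ x, Φ x * w q x ∂μ)
      rw [abs_sub_comm] at h4
      linarith
    have h3 := Finset.sum_le_sum fun q (_ : q ∈ Finset.univ) => h2 q
    rw [Finset.sum_add_distrib] at h3
    linarith
  filter_upwards [eventually_avg_integral_le_of_memLp ψ hw hw0 hw1 hwv hΓ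
    (s.memLp_of_isFiniteMeasure 2 μ) (show 0 < ε / 3 by positivity)] with F hF
  have h1 : avg F (fun g => ∫ x, Φ x * Γ (ψ g +ᵥ x) ∂μ) -
      avg F (fun g => ∫ x, s x * Γ (ψ g +ᵥ x) ∂μ) ≤ ε / 3 := by
    rw [← avg_sub]
    exact (Real.le_norm_self _).trans (norm_avg_le (C := ε / 3) (by positivity) fun g _ => hdiff' _ (hΓ.vadd _))
  linarith

end Correlations

/-! ### Convergence of the triple averages -/

noncomputable section TripleAverages

variable {G X : Type*} [AddCommGroup G] [MeasurableSpace X] [AddAction G X]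
  [MeasurableConstVAdd G X] {μ : Measure X} [IsProbabilityMeasure μ]

/-- For a vector `f` that is weakly mixing for `U`, the correlations of its translates, twisted by a
contraction, are small on average over large squares. -/
lemma tendsto_avg_avg_abs_inner {H : Type*} [NormedAddCommGroup H] [InnerProductSpace ℝ H]
    [CompleteSpace H] {U : G → H →ₗᵢ[ℝ] H} (hU : IsIsometricRep U) {f : H}
    (hf : f ∈ (almostPeriodic U)ᗮ) (M : H →L[ℝ] H) (hM : ∀ x, ‖M x‖ ≤ ‖x‖) :
    Tendsto (fun E => avg E (fun h => avg E (fun h' => |inner ℝ (M (U h f)) (U h' f)|)))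
      (folnerFilter G) (𝓝 0) := by
  have h0 : Tendsto (fun E => √(‖orbitOperator U f E‖ * ‖f‖ ^ 2)) (folnerFilter G) (𝓝 0) := by
    have := (((hU.tendsto_orbitOperator hf).norm.mul_const (‖f‖ ^ 2)).sqrt)
    simpa using this
  refine squeeze_zero (fun E => avg_nonneg fun h _ => avg_nonneg fun h' _ => abs_nonneg _)
    (fun E => ?_) h0
  have key : ∀ h, ‖avg E (fun h' => |inner ℝ (M (U h f)) (U h' f)|)‖ ≤
      √(‖orbitOperator U f E‖ * ‖f‖ ^ 2) := by
    intro h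
    set y := M (U h f)
    have hy : ‖y‖ ≤ ‖f‖ := by simpa using hM (U h f)
    refine Real.abs_le_sqrt ((sq_avg_le _ _).trans ?_)
    have h1 : avg E (fun h' => |inner ℝ y (U h' f)| ^ 2) = inner ℝ (orbitOperator U f E y) y := by
      rw [inner_orbitOperator]
      congr 1; ext h'
      rw [sq_abs, real_inner_comm, sq]
    rw [h1]
    calc inner ℝ (orbitOperator U f E y) y ≤ ‖orbitOperator U f E y‖ * ‖y‖ := real_inner_le_norm _ _
      _ ≤ ‖orbitOperator U f E‖ * ‖y‖ * ‖y‖ := by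
        gcongr
        exact ContinuousLinearMap.le_opNorm _ _
      _ = ‖orbitOperator U f E‖ * ‖y‖ ^ 2 := by ring
      _ ≤ _ := by gcongr
  exact (Real.le_norm_self _).trans (norm_avg_le (Real.sqrt_nonneg _) fun h _ => key h)

/-- If `f` is weakly mixing for `g ↦ T_{α g}` and `γ = -(α + β)` has an image of finite index, then
the products `T_{α g} f · T_{β g} b` average to zero in `L²`. In van der Corput's lemma the
correlations of these products depend on `g` only through `T_{γ g}`, so finite index and ergodicity
bound them by finitely many correlations of the translates of `f`. -/
theorem tendsto_avg_mulOp_koopman [ErgodicVAdd G X μ] (α β γ : G →+ G)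
    (hαβγ : ∀ g, β g - α g = γ g) (hγ : γ.range.FiniteIndex)
    {b : X → ℝ} (hb : IsUnitBounded b) {f : Lp ℝ 2 μ}
    (hf : f ∈ (almostPeriodic fun g => koopman μ (α g))ᗮ) :
    Tendsto (fun F => avg F (fun g => (hb.vadd (β g)).mulOp μ (koopman μ (α g) f)))
      (folnerFilter G) (𝓝 0) := by
  rcases (folnerFilter G).eq_or_neBot with hbot | hbot
  · simp [hbot]
  have hfin : Fintype (G ⧸ γ.range) := Fintype.ofFinite _
  obtain ⟨w, hwm, hw0, hwle, hw1, hwv⟩ := exists_partition_of_finiteIndex (μ := μ) γ.range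
  have hw : ∀ q, IsUnitBounded (w q) := fun q => ⟨hwm q, fun x => by
    rw [abs_of_nonneg (hw0 q x)]; exact hwle q x⟩
  have hU := (isIsometricRep_koopman (G := G) (μ := μ)).comp α
  refine tendsto_avg_of_van_der_corput (C := ‖f‖)
    (fun g => ((hb.vadd (β g)).norm_mulOp_le _).trans_eq (by simp))
    (fun h h' => ∑ q, |inner ℝ ((hw q).mulOp μ (koopman μ (α h) f)) (koopman μ (α h') f)|) ?_ ?_
  · intro h h' ε hε
    set Φ : X → ℝ := fun x => koopman μ (α h) f x * koopman μ (α h') f x with hΦ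
    have hΦi : Integrable Φ μ :=
      (Lp.memLp (koopman μ (α h) f)).integrable_mul (Lp.memLp (koopman μ (α h') f))
    filter_upwards [eventually_avg_integral_le γ hw hw0 hw1 hwv
      ((hb.vadd (β h)).mul (hb.vadd (β h'))) hΦi hε] with F hF
    refine le_trans (le_of_eq ?_) (hF.trans_eq ?_)
    · congr 1; ext g
      rw [inner_Lp_eq_integral,
        ← integral_vadd_eq_self (fun x => Φ x * _) (g := α g)]
      refine integral_congr_ae ?_
      have hq := (measurePreserving_vadd (α g) μ).quasiMeasurePreserving
      filter_upwards [(hb.vadd (β (h + g))).coeFn_mulOp (koopman μ (α (h + g)) f),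
        (hb.vadd (β (h' + g))).coeFn_mulOp (koopman μ (α (h' + g)) f),
        coeFn_koopman (α (h + g)) f, coeFn_koopman (α (h' + g)) f,
        hq.ae (coeFn_koopman (α h) f), hq.ae (coeFn_koopman (α h') f)] with x h1 h2 h3 h4 h5 h6
      rw [h1, h2, h3, h4]
      simp only [hΦ, h5, h6, vadd_vadd, map_add, ← hαβγ]
      have e1 : ∀ k, β k + (β g - α g + α g) = β k + β g := fun k => by abel
      simp only [e1]
      ring
    · congr 1
      refine Finset.sum_congr rfl fun q _ => ?_
      congr 1
      rw [inner_Lp_eq_integral]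
      refine integral_congr_ae ?_
      filter_upwards [(hw q).coeFn_mulOp (koopman μ (α h) f)] with x hx
      rw [hx]; ring
  · intro ε hε
    have h1 : Tendsto (fun E => ∑ q, avg E (fun h => avg E (fun h' =>
        |inner ℝ ((hw q).mulOp μ (koopman μ (α h) f)) (koopman μ (α h') f)|)))
        (folnerFilter G) (𝓝 0) := by
      have := tendsto_finsetSum Finset.univ fun q (_ : q ∈ Finset.univ) =>
        tendsto_avg_avg_abs_inner hU hf ((hw q).mulOp μ) (hw q).norm_mulOp_le
      simpa using this
    obtain ⟨E, hE, hEn⟩ := ((h1.eventually_le_const hε).and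
      eventually_nonempty_folnerFilter).exists
    refine ⟨E, hEn, le_trans (le_of_eq ?_) hE⟩
    simp only [avg_sum]

/-- The averages of the triple correlations converge. The middle function is split into an almost
periodic part, whose contribution converges by the mean ergodic theorem, and a weakly mixing part,
whose contribution tends to zero. -/
theorem hasCauchyAvg_triple_correlation [ErgodicVAdd G X μ] (α β γ : G →+ G)
    (hαβγ : ∀ g, β g - α g = γ g) (hγ : γ.range.FiniteIndex)
    {a f b : X → ℝ} (ha : IsUnitBounded a) (hf : IsUnitBounded f) (hb : IsUnitBounded b) :
    HasCauchyAvg (fun g => ∫ x, a x * f (α g +ᵥ x) * b (β g +ᵥ x) ∂μ) := by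
  have hU := (isIsometricRep_koopman (G := G) (μ := μ)).comp α
  have hV := (isIsometricRep_koopman (G := G) (μ := μ)).comp β
  set K := almostPeriodic fun g => koopman μ (α g) with hK
  have : CompleteSpace K := (isClosed_almostPeriodic _).completeSpace_coe
  set p : Lp ℝ 2 μ := K.starProjection (hf.toL2 μ) with hp
  set r : Lp ℝ 2 μ := hf.toL2 μ - p with hr
  have h1 : HasCauchyAvg (fun g => inner ℝ (koopman μ (α g) p)
      (ha.mulOp μ (koopman μ (β g) (hb.toL2 μ)))) :=
    hasCauchyAvg_inner_of_mem_almostPeriodic hU hV (ha.mulOp μ)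
      (K.starProjection_apply_mem _) _
  have hrK : r ∈ Kᗮ := K.sub_starProjection_mem_orthogonal _
  have h2 : HasCauchyAvg (fun g => inner ℝ (ha.toL2 μ)
      ((hb.vadd (β g)).mulOp μ (koopman μ (α g) r))) := by
    have := ((innerSL ℝ (ha.toL2 μ)).continuous.tendsto 0).comp
      (tendsto_avg_mulOp_koopman α β γ hαβγ hγ hb hrK)
    refine Tendsto.hasCauchyAvg (this.congr fun F => ?_)
    simp only [Function.comp, map_avg]
    rfl
  convert h1.add h2 using 2 with g
  rw [inner_Lp_eq_integral, inner_Lp_eq_integral, ← integral_add]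
  · have hsum : p + r = hf.toL2 μ := by rw [hr]; abel
    have hkoop : koopman μ (α g) p + koopman μ (α g) r = (hf.vadd (α g)).toL2 μ := by
      rw [← map_add, hsum, IsUnitBounded.koopman_toL2]
    have hco := Lp.coeFn_add (koopman μ (α g) p) (koopman μ (α g) r)
    rw [hkoop] at hco
    refine integral_congr_ae ?_
    filter_upwards [hco, (hf.vadd (α g)).coeFn_toL2 (μ := μ), ha.coeFn_toL2 (μ := μ),
      ha.coeFn_mulOp (koopman μ (β g) (hb.toL2 μ)), (hb.vadd (β g)).coeFn_toL2 (μ := μ),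
      (hb.vadd (β g)).coeFn_mulOp (koopman μ (α g) r)] with x e1 e2 e3 e4 e5 e6
    rw [e4, e6, e3, IsUnitBounded.koopman_toL2, e5, ← e2, e1, Pi.add_apply]
    ring
  · exact (Lp.memLp (koopman μ (α g) p)).integrable_mul (Lp.memLp _)
  · exact (Lp.memLp (ha.toL2 μ)).integrable_mul (Lp.memLp _)

end TripleAverages

/-! ### Invariant measures carried by an orbit closure -/

noncomputable section InvariantMeasures

section General

variable {G X : Type*} [AddCommGroup G] [AddAction G X]

/-- The frequency of visits of the orbit of `x` to `C` at the times `t ∈ F`. -/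
def visitFreq (C : Set X) (F : Finset G) (x : X) : ℝ :=
  avg F (fun t => C.indicator (fun _ => (1 : ℝ)) (t +ᵥ x))

/-- The empirical measure of the orbit of `a` along `F` exists as a probability measure. -/
lemma exists_empirical_measure [MeasurableSpace X] (a : X) {F : Finset G} (hF : F.Nonempty) :
    ∃ μ : ProbabilityMeasure X, ∀ C, MeasurableSet C →
      (μ : Measure X).real C = visitFreq C F a := by
  have hc : (F.card : ENNReal) ≠ 0 := by exact_mod_cast hF.card_pos.ne'
  refine ⟨⟨(F.card : ENNReal)⁻¹ • ∑ t ∈ F, Measure.dirac (t +ᵥ a), ⟨?_⟩⟩, fun C hC => ?_⟩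
  · simp [ENNReal.inv_mul_cancel hc (ENNReal.natCast_ne_top _)]
  · simp only [visitFreq, avg, ProbabilityMeasure.coe_mk, measureReal_def, Measure.smul_apply,
      Measure.finsetSum_apply, smul_eq_mul, ENNReal.toReal_mul, ENNReal.toReal_inv,
      ENNReal.toReal_natCast, Measure.dirac_apply' _ hC]
    congr 1
    rw [ENNReal.toReal_sum]
    · refine Finset.sum_congr rfl fun t _ => ?_
      by_cases h : t +ᵥ a ∈ C <;> simp [h]
    · intro t _
      by_cases h : t +ᵥ a ∈ C <;> simp [h]

lemma visitFreq_preimage (C : Set X) (g : G) (F : Finset G) (x : X) :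
    visitFreq ((g +ᵥ ·) ⁻¹' C) F x =
      avg F (fun t => C.indicator (fun _ => (1 : ℝ)) ((g + t) +ᵥ x)) := by
  simp only [visitFreq, add_vadd]
  rfl

lemma cond_measureReal_apply [MeasurableSpace X] {B : Set X} (hB : MeasurableSet B) (μ : Measure X)
    (C : Set X) :
    (ProbabilityTheory.cond μ B).real C = (μ.real B)⁻¹ * μ.real (B ∩ C) := by
  simp [measureReal_def, ProbabilityTheory.cond_apply hB]

lemma IsClopen.preimage_vadd [TopologicalSpace X] [ContinuousConstVAdd G X] {C : Set X}
    (hC : IsClopen C) (g : G) : IsClopen ((g +ᵥ ·) ⁻¹' C) :=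
  hC.preimage (continuous_const_vadd g)

lemma continuous_measureReal_of_isClopen [TopologicalSpace X] [MeasurableSpace X]
    [OpensMeasurableSpace X] [HasOuterApproxClosed X] {C : Set X} (hC : IsClopen C) :
    Continuous fun μ : ProbabilityMeasure X => (μ : Measure X).real C := by
  have : Continuous fun μ : ProbabilityMeasure X => μ C := continuous_iff_continuousAt.2 fun μ =>
    ProbabilityMeasure.tendsto_measure_of_isClopen_of_tendsto tendsto_id hC
  exact NNReal.continuous_coe.comp this

end General

variable {G X : Type*} [AddCommGroup G] [AddAction G X] [TopologicalSpace X] [CompactSpace X]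
  [T2Space X] [TotallyDisconnectedSpace X] [SecondCountableTopology X]
  [MeasurableSpace X] [BorelSpace X]

/-- In a second countable profinite space a finite measure is determined by the clopen sets. -/
lemma measure_eq_of_isClopen {μ ν : Measure X} [IsFiniteMeasure μ]
    (h : ∀ C, IsClopen C → μ C = ν C) : μ = ν := by
  refine ext_of_generate_finite {C : Set X | IsClopen C} ?_ ?_ (fun C hC => h C hC)
    (h _ isClopen_univ)
  · rw [BorelSpace.measurable_eq (α := X)]
    exact isTopologicalBasis_isClopen.borel_eq_generateFrom
  · exact fun C hC C' hC' _ => IsClopen.inter hC hC'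

variable (G) in
/-- The `G`-invariant probability measures carried by the orbit closure of `a`; both conditions are
expressed by means of clopen sets. -/
def orbitMeasures (a : X) : Set (ProbabilityMeasure X) :=
  {μ | (∀ (g : G) (C : Set X), IsClopen C →
      (μ : Measure X).real ((g +ᵥ ·) ⁻¹' C) = (μ : Measure X).real C) ∧
    ∀ C : Set X, IsClopen C → (∀ t : G, t +ᵥ a ∉ C) → (μ : Measure X).real C = 0}

variable [ContinuousConstVAdd G X]

omit [TotallyDisconnectedSpace X] [SecondCountableTopology X] in
lemma isCompact_orbitMeasures [HasOuterApproxClosed X] (a : X) :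
    IsCompact (orbitMeasures G a) := by
  refine IsClosed.isCompact ?_
  simp only [orbitMeasures, Set.ofPred_and, Set.ofPred_forall]
  refine IsClosed.inter ?_ ?_
  · refine isClosed_iInter fun g => isClosed_iInter fun C => isClosed_iInter fun hC => ?_
    exact isClosed_eq (continuous_measureReal_of_isClopen (hC.preimage_vadd g))
      (continuous_measureReal_of_isClopen hC)
  · refine isClosed_iInter fun C => isClosed_iInter fun hC => isClosed_iInter fun _ => ?_
    exact isClosed_eq (continuous_measureReal_of_isClopen hC) continuous_const

lemma vaddInvariantMeasure_of_mem_orbitMeasures {a : X} {μ : ProbabilityMeasure X}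
    (hμ : μ ∈ orbitMeasures G a) : VAddInvariantMeasure G X (μ : Measure X) := by
  refine ⟨fun g s hs => ?_⟩
  have hm : Measurable fun x : X => g +ᵥ x := (continuous_const_vadd g).measurable
  have h : Measure.map (g +ᵥ ·) (μ : Measure X) = μ := by
    have := Measure.isProbabilityMeasure_map (μ := (μ : Measure X)) hm.aemeasurable
    refine measure_eq_of_isClopen fun C hC => ?_
    rw [Measure.map_apply hm hC.isOpen.measurableSet]
    exact (measureReal_eq_measureReal_iff).1 (hμ.1 g C hC)
  rw [← Measure.map_apply hm hs, h]

/-- Conditioning on an invariant set preserves invariance and does not enlarge the support. -/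
lemma cond_mem_orbitMeasures {a : X} {μ ν : ProbabilityMeasure X} (hμ : μ ∈ orbitMeasures G a)
    {B : Set X} (hB : MeasurableSet B) (hinv : ∀ g : G, (g +ᵥ ·) ⁻¹' B =ᵐ[(μ : Measure X)] B)
    (hν : (ν : Measure X) = ProbabilityTheory.cond (μ : Measure X) B) :
    ν ∈ orbitMeasures G a := by
  have := vaddInvariantMeasure_of_mem_orbitMeasures hμ
  have hreal : ∀ C : Set X, (ν : Measure X).real C =
      ((μ : Measure X).real B)⁻¹ * (μ : Measure X).real (B ∩ C) := fun C => by
    rw [hν, cond_measureReal_apply hB]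
  refine ⟨fun g C hC => ?_, fun C hC h => ?_⟩
  · rw [hreal, hreal]
    congr 1
    have hm : MeasurePreserving (fun x : X => g +ᵥ x) (μ : Measure X) μ :=
      ⟨(continuous_const_vadd g).measurable, by
        ext s hs
        rw [Measure.map_apply (continuous_const_vadd g).measurable hs]
        exact this.measure_preimage_vadd g hs⟩
    rw [← hm.measureReal_preimage (hB.inter hC.isOpen.measurableSet).nullMeasurableSet]
    exact measureReal_congr ((hinv g).symm.inter (ae_eq_refl _))
  · rw [hreal]
    have h0 := hμ.2 C hC h
    have : (μ : Measure X).real (B ∩ C) ≤ 0 := h0 ▸ measureReal_mono Set.inter_subset_right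
    rw [le_antisymm this measureReal_nonneg, mul_zero]

/-- If some invariant measure on the orbit closure gives the clopen set `C₀` the measure `s`, and
none gives it more, then some ergodic one does: any extreme point of the set of these measures. -/
theorem exists_ergodic_of_isMax [HasOuterApproxClosed X] {a : X} {C₀ : Set X} (hC₀ : IsClopen C₀)
    {s : ℝ} (hmax : ∀ μ ∈ orbitMeasures G a, (μ : Measure X).real C₀ ≤ s)
    (hex : ∃ μ ∈ orbitMeasures G a, (μ : Measure X).real C₀ = s) :
    ∃ μ ∈ orbitMeasures G a, (μ : Measure X).real C₀ = s ∧ ErgodicVAdd G X (μ : Measure X) := by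
  set M₀ : Set (ProbabilityMeasure X) :=
    orbitMeasures G a ∩ {μ | (μ : Measure X).real C₀ = s} with hM₀
  have hM₀c : IsCompact M₀ := (isCompact_orbitMeasures a).inter_right
    (isClosed_eq (continuous_measureReal_of_isClopen hC₀) continuous_const)
  set E : ProbabilityMeasure X → ({C : Set X // IsClopen C} → ℝ) :=
    fun μ C => (μ : Measure X).real C with hE
  have hEc : Continuous E := continuous_pi fun C => continuous_measureReal_of_isClopen C.2
  obtain ⟨_, hext⟩ := (hM₀c.image hEc).extremePoints_nonempty (by
    obtain ⟨μ, h1, h2⟩ := hex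
    exact ⟨_, μ, ⟨h1, h2⟩, rfl⟩)
  obtain ⟨⟨μ, hμ, rfl⟩, hext⟩ := mem_extremePoints_iff_left.1 hext
  have hinvμ := vaddInvariantMeasure_of_mem_orbitMeasures hμ.1
  refine ⟨μ, hμ.1, hμ.2, ⟨fun {B} hB hinv => ?_⟩⟩
  by_contra hcon
  have hB0 : (μ : Measure X) B ≠ 0 := fun h => hcon (eventuallyConst_set.2 (Or.inr (by
    rw [ae_iff]; simpa using h)))
  have hB1 : (μ : Measure X) Bᶜ ≠ 0 := fun h => hcon (eventuallyConst_set.2 (Or.inl (by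
    rw [ae_iff]; exact h)))
  have hinv' : ∀ g : G, (g +ᵥ ·) ⁻¹' Bᶜ =ᵐ[(μ : Measure X)] Bᶜ := fun g => (hinv g).compl
  set ν : ProbabilityMeasure X := ⟨_, ProbabilityTheory.cond_isProbabilityMeasure hB0⟩ with hν
  set ν' : ProbabilityMeasure X := ⟨_, ProbabilityTheory.cond_isProbabilityMeasure hB1⟩ with hν'
  have hνM : ν ∈ orbitMeasures G a := cond_mem_orbitMeasures hμ.1 hB hinv rfl
  have hν'M : ν' ∈ orbitMeasures G a := cond_mem_orbitMeasures hμ.1 hB.compl hinv' rfl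
  set t := (μ : Measure X).real B with ht
  set t' := (μ : Measure X).real Bᶜ with ht'
  have ht0 : 0 < t := ENNReal.toReal_pos hB0 (measure_ne_top _ _)
  have ht'0 : 0 < t' := ENNReal.toReal_pos hB1 (measure_ne_top _ _)
  have htt' : t + t' = 1 := by
    rw [ht, ht', measureReal_add_measureReal_compl hB, probReal_univ]
  have hconv : ∀ C : Set X, MeasurableSet C → t * (ν : Measure X).real C +
      t' * (ν' : Measure X).real C = (μ : Measure X).real C := by
    intro C hC
    have h1 : (ν : Measure X).real C = t⁻¹ * (μ : Measure X).real (B ∩ C) :=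
      cond_measureReal_apply hB _ _
    have h2 : (ν' : Measure X).real C = t'⁻¹ * (μ : Measure X).real (Bᶜ ∩ C) :=
      cond_measureReal_apply hB.compl _ _
    rw [h1, h2, mul_inv_cancel_left₀ ht0.ne', mul_inv_cancel_left₀ ht'0.ne',
      Set.inter_comm B, Set.inter_comm Bᶜ, ← Set.sdiff_eq]
    exact measureReal_inter_add_sdiff hB
  have hC₀eq := hconv C₀ hC₀.isOpen.measurableSet
  rw [hμ.2] at hC₀eq
  have hν1 := hmax ν hνM
  have hν'1 := hmax ν' hν'M
  have hs : t * s + t' * s = s := by rw [← add_mul, htt', one_mul]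
  have e1 := mul_le_mul_of_nonneg_left hν1 ht0.le
  have e2 := mul_le_mul_of_nonneg_left hν'1 ht'0.le
  have hνs : (ν : Measure X).real C₀ = s := mul_left_cancel₀ ht0.ne' (by linarith)
  have hν's : (ν' : Measure X).real C₀ = s := mul_left_cancel₀ ht'0.ne' (by linarith)
  have hEeq := hext (E ν) ⟨ν, ⟨hνM, hνs⟩, rfl⟩ (E ν') ⟨ν', ⟨hν'M, hν's⟩, rfl⟩
    ⟨t, t', ht0, ht'0, htt', by
      ext C
      simpa [hE] using hconv C C.2.isOpen.measurableSet⟩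
  have hμν : (ν : Measure X) = μ := measure_eq_of_isClopen fun C hC =>
    (measureReal_eq_measureReal_iff).1 (congrFun hEeq ⟨C, hC⟩)
  refine hB1 ?_
  rw [← hμν]
  change ProbabilityTheory.cond (μ : Measure X) B Bᶜ = 0
  rw [ProbabilityTheory.cond_apply hB]
  simp

omit [TotallyDisconnectedSpace X] [SecondCountableTopology X] in
/-- If arbitrarily invariant finite sets `F` have visit frequency at least `c`, some invariant
measure on the orbit closure gives `C₀` measure at least `c`: a limit of empirical measures. -/
lemma exists_mem_orbitMeasures_of_frequently [HasOuterApproxClosed X] (a : X) {C₀ : Set X}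
    (hC₀ : IsClopen C₀) {c : ℝ} (h : ∃ᶠ F in folnerFilter G, c ≤ visitFreq C₀ F a) :
    ∃ μ ∈ orbitMeasures G a, c ≤ (μ : Measure X).real C₀ := by
  have hne : (folnerFilter G ⊓ 𝓟 {F | c ≤ visitFreq C₀ F a}).NeBot :=
    frequently_mem_iff_neBot.1 h
  set 𝒰 := Ultrafilter.of (folnerFilter G ⊓ 𝓟 {F | c ≤ visitFreq C₀ F a})
  have h𝒰 : (𝒰 : Filter (Finset G)) ≤ folnerFilter G ⊓ 𝓟 {F | c ≤ visitFreq C₀ F a} :=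
    Ultrafilter.of_le _
  choose e he using fun F : {F : Finset G // F.Nonempty} => exists_empirical_measure a F.2
  classical
  set m : Finset G → ProbabilityMeasure X := fun F =>
    if hF : F.Nonempty then e ⟨F, hF⟩ else diracProba a with hm
  obtain ⟨μ, hμ⟩ : ∃ μ, Tendsto m 𝒰 (𝓝 μ) := ⟨_, (Ultrafilter.map m 𝒰).le_nhds_lim⟩
  have hfreq : ∀ C, IsClopen C →
      Tendsto (fun F : Finset G => visitFreq C F a) 𝒰 (𝓝 ((μ : Measure X).real C)) := by
    intro C hC
    refine (((continuous_measureReal_of_isClopen hC).tendsto μ).comp hμ).congr' ?_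
    filter_upwards [(h𝒰.trans inf_le_left) eventually_nonempty_folnerFilter] with F hF
    have hF' : F.Nonempty := hF
    simp only [Function.comp, hm, dif_pos hF']
    exact he ⟨F, hF'⟩ C hC.isOpen.measurableSet
  refine ⟨μ, ⟨fun g C hC => ?_, fun C hC hCa => ?_⟩, ?_⟩
  · have h1 := (hfreq _ (hC.preimage_vadd g)).sub (hfreq C hC)
    have h2 := (tendsto_avg_shift_sub (u := fun t : G => C.indicator (fun _ => (1 : ℝ)) (t +ᵥ a))
      (C := 1) (fun t => by by_cases h : t +ᵥ a ∈ C <;> simp [h]) g).mono_left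
      (h𝒰.trans inf_le_left)
    simp only [visitFreq_preimage] at h1
    exact sub_eq_zero.1 (tendsto_nhds_unique h1 h2)
  · refine tendsto_nhds_unique (hfreq C hC) (tendsto_const_nhds.congr fun F => ?_)
    simp [visitFreq, avg, hCa]
  · exact ge_of_tendsto (hfreq C₀ hC₀) (h𝒰.trans inf_le_right (mem_principal_self _))

omit [CompactSpace X] [T2Space X] [TotallyDisconnectedSpace X] [SecondCountableTopology X] in
/-- An invariant measure on the orbit closure of `a` cannot exceed all the visit frequencies of
the points of the orbit along a given finite set. -/
lemma exists_le_visitFreq_of_mem_orbitMeasures {a : X} {μ : ProbabilityMeasure X}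
    (hμ : μ ∈ orbitMeasures G a) {C₀ : Set X} (hC₀ : IsClopen C₀) {F : Finset G}
    (hF : F.Nonempty) : ∃ t : G, (μ : Measure X).real C₀ ≤ visitFreq C₀ F (t +ᵥ a) := by
  -- the number of visits is continuous with values in `ℕ`, so its level sets are clopen
  have hcont : Continuous (fun x : X => C₀.indicator (fun _ => (1 : ℕ)) x) :=
    continuous_const.indicator (by simp [hC₀.frontier_eq])
  set n : X → ℕ := fun x => ∑ t ∈ F, C₀.indicator (fun _ => (1 : ℕ)) (t +ᵥ x) with hn
  have hnc : Continuous n := continuous_finsetSum _ fun t _ =>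
    hcont.comp (continuous_const_vadd t)
  have hvn : ∀ x, visitFreq C₀ F x = (F.card : ℝ)⁻¹ * n x := by
    intro x
    simp only [visitFreq, avg, smul_eq_mul, hn, Nat.cast_sum]
    congr 1
    refine Finset.sum_congr rfl fun t _ => ?_
    by_cases h : t +ᵥ x ∈ C₀ <;> simp [h]
  set D : Set X := n ⁻¹' {k | (μ : Measure X).real C₀ ≤ (F.card : ℝ)⁻¹ * k} with hD
  have hDc : IsClopen D := (isClopen_discrete _).preimage hnc
  by_contra! hcon
  have hD0 : (μ : Measure X).real D = 0 := hμ.2 D hDc fun t ht => by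
    have h1 := hcon t
    rw [hvn] at h1
    exact absurd ht (not_le.2 h1)
  have hind : ∀ t : G, Integrable (fun x => C₀.indicator (fun _ => (1 : ℝ)) (t +ᵥ x))
      (μ : Measure X) := fun t => by
    have := (integrable_const (μ := (μ : Measure X)) (1 : ℝ)).indicator
      (hC₀.preimage_vadd t).isOpen.measurableSet
    exact this
  have hint : Integrable (visitFreq C₀ F) (μ : Measure X) :=
    (integrable_finsetSum F fun t _ => hind t).smul (F.card : ℝ)⁻¹
  have hval : ∫ x, visitFreq C₀ F x ∂(μ : Measure X) = (μ : Measure X).real C₀ := by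
    have h1 : ∫ x, visitFreq C₀ F x ∂(μ : Measure X) = avg F (fun t =>
        ∫ x, C₀.indicator (fun _ => (1 : ℝ)) (t +ᵥ x) ∂(μ : Measure X)) := by
      simp only [visitFreq, avg]
      rw [integral_smul, integral_finsetSum _ fun t _ => hind t]
    have h2 : ∀ t : G, ∫ x, C₀.indicator (fun _ => (1 : ℝ)) (t +ᵥ x) ∂(μ : Measure X) =
        (μ : Measure X).real C₀ := by
      intro t
      rw [← hμ.1 t C₀ hC₀]
      exact integral_indicator_one (hC₀.preimage_vadd t).isOpen.measurableSet
    rw [h1]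
    simp only [h2, avg_const hF]
  obtain ⟨x, hxD, hx⟩ := exists_notMem_null_integral_le hint
    ((measureReal_eq_zero_iff).1 hD0)
  rw [hval, hvn] at hx
  exact hxD hx

end InvariantMeasures

/-! ### Upper Banach density and the shift space -/

noncomputable section ShiftSystem

/-- The space of `0`-`1` sequences indexed by `G`. -/
def ShiftSpace (G : Type u) : Type u := G → Bool

namespace ShiftSpace

variable {G : Type u}

instance : TopologicalSpace (ShiftSpace G) := inferInstanceAs (TopologicalSpace (G → Bool))
instance : CompactSpace (ShiftSpace G) := inferInstanceAs (CompactSpace (G → Bool))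
instance : T2Space (ShiftSpace G) := inferInstanceAs (T2Space (G → Bool))
instance : TotallyDisconnectedSpace (ShiftSpace G) :=
  inferInstanceAs (TotallyDisconnectedSpace (G → Bool))
instance : MeasurableSpace (ShiftSpace G) := inferInstanceAs (MeasurableSpace (G → Bool))
instance [Countable G] : SecondCountableTopology (ShiftSpace G) :=
  inferInstanceAs (SecondCountableTopology (G → Bool))
instance [Countable G] : BorelSpace (ShiftSpace G) := inferInstanceAs (BorelSpace (G → Bool))
instance [Countable G] : HasOuterApproxClosed (ShiftSpace G) :=
  inferInstanceAs (HasOuterApproxClosed (G → Bool))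
instance [Countable G] : MeasurableSpace.CountablyGenerated (ShiftSpace G) :=
  inferInstanceAs (MeasurableSpace.CountablyGenerated (G → Bool))

variable [AddCommGroup G]

/-- The shift action: `g +ᵥ x` is the sequence `s ↦ x (s + g)`. -/
instance : AddAction G (ShiftSpace G) where
  vadd g x := fun s => x (s + g)
  zero_vadd x := funext fun s => congrArg x (add_zero s)
  add_vadd g h x := funext fun s => congrArg x (by rw [add_assoc, add_comm g h])

lemma vadd_apply (g : G) (x : ShiftSpace G) (s : G) : (g +ᵥ x) s = x (s + g) := rfl

instance : ContinuousConstVAdd G (ShiftSpace G) :=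
  ⟨fun g => continuous_pi fun s => continuous_apply (s + g)⟩

instance : MeasurableConstVAdd G (ShiftSpace G) :=
  ⟨fun g => measurable_pi_lambda _ fun s => measurable_pi_apply (s + g)⟩

variable (G) in
/-- The cylinder of the sequences with value `1` at the origin. -/
def cylinder : Set (ShiftSpace G) := {x | x 0 = true}

lemma isClopen_cylinder : IsClopen (cylinder G) :=
  (isClopen_discrete {true}).preimage (continuous_apply (0 : G))

open scoped Classical in
/-- The indicator of `A` as a point of the shift space. -/
def point (A : Set G) : ShiftSpace G := fun s => decide (s ∈ A)

lemma vadd_point_mem_cylinder (A : Set G) (t : G) :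
    t +ᵥ point A ∈ cylinder G ↔ t ∈ A := by
  change (t +ᵥ point A) 0 = true ↔ t ∈ A
  simp [vadd_apply, point]

end ShiftSpace

variable {G : Type u} [AddCommGroup G]

open ShiftSpace

open scoped Classical in
lemma visitFreq_point (A : Set G) (F : Finset G) :
    visitFreq (cylinder G) F (point A) = ((F.filter (fun x => x ∈ A)).card : ℝ) / F.card := by
  rw [visitFreq, avg_eq_div, Finset.card_filter]
  push_cast
  congr 1
  refine Finset.sum_congr rfl fun t _ => ?_
  simp [Set.indicator_apply, vadd_point_mem_cylinder]

open scoped Classical in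
lemma visitFreq_vadd_point (A : Set G) (F : Finset G) (t : G) :
    visitFreq (cylinder G) F (t +ᵥ point A) =
      visitFreq (cylinder G) (F.image (fun x => x + t)) (point A) := by
  simp only [visitFreq, avg_eq_div]
  rw [Finset.sum_image (add_left_injective t).injOn,
    Finset.card_image_of_injective _ (add_left_injective t)]
  simp only [add_vadd]

lemma visitFreq_le_one {X : Type*} [AddAction G X] (C : Set X) (F : Finset G) (x : X) :
    visitFreq C F x ≤ 1 := by
  refine (Real.le_norm_self _).trans (norm_avg_le zero_le_one fun t _ => ?_)
  by_cases h : t +ᵥ x ∈ C <;> simp [h]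

lemma visitFreq_nonneg {X : Type*} [AddAction G X] (C : Set X) (F : Finset G) (x : X) :
    0 ≤ visitFreq C F x :=
  avg_nonneg fun _ _ => Set.indicator_nonneg (fun _ _ => zero_le_one) _

lemma upperDensityAlong_eq (F : ℕ → Finset G) (A : Set G) :
    upperDensityAlong F A =
      limsup (fun N => visitFreq (cylinder G) (F N) (point A)) atTop := by
  simp only [upperDensityAlong, visitFreq_point]

lemma isBoundedUnder_visitFreq (F : ℕ → Finset G) (A : Set G) :
    IsBoundedUnder (· ≤ ·) atTop (fun N => visitFreq (cylinder G) (F N) (point A)) :=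
  isBoundedUnder_of ⟨1, fun _ => visitFreq_le_one _ _ _⟩

lemma isCoboundedUnder_visitFreq (F : ℕ → Finset G) (A : Set G) :
    IsCoboundedUnder (· ≤ ·) atTop (fun N => visitFreq (cylinder G) (F N) (point A)) :=
  (isBoundedUnder_of (r := (· ≥ ·)) ⟨0, fun _ => visitFreq_nonneg _ _ _⟩).isCoboundedUnder_le

lemma upperDensityAlong_le_upperBanachDensity {F : ℕ → Finset G} (hF : IsFolnerSeq F) (A : Set G) :
    upperDensityAlong F A ≤ upperBanachDensity A := by
  refine le_csSup ⟨1, ?_⟩ ⟨F, hF, rfl⟩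
  rintro _ ⟨F', -, rfl⟩
  rw [upperDensityAlong_eq]
  exact limsup_le_of_le (isCoboundedUnder_visitFreq F' A)
    (Eventually.of_forall fun _ => visitFreq_le_one _ _ _)

lemma exists_isFolnerSeq_of_lt_upperBanachDensity {A : Set G} (hA : 0 < upperBanachDensity A)
    {c : ℝ} (hc : c < upperBanachDensity A) :
    ∃ F : ℕ → Finset G, IsFolnerSeq F ∧ c < upperDensityAlong F A := by
  have hne : {d : ℝ | ∃ F : ℕ → Finset G, IsFolnerSeq F ∧ d = upperDensityAlong F A}.Nonempty := by
    by_contra h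
    rw [Set.not_nonempty_iff_eq_empty] at h
    rw [upperBanachDensity, h, Real.sSup_empty] at hA
    exact lt_irrefl _ hA
  obtain ⟨_, ⟨F, hF, rfl⟩, h⟩ := exists_lt_of_lt_csSup hne hc
  exact ⟨F, hF, h⟩

open scoped Classical in
lemma IsFolnerSeq.image_add {F : ℕ → Finset G} (hF : IsFolnerSeq F) (t : ℕ → G) :
    IsFolnerSeq (fun N => (F N).image (fun x => x + t N)) := by
  refine ⟨fun N => (hF.nonempty N).image _, fun g => (hF.tendsto_symmDiff g).congr fun N => ?_⟩
  have hinj := add_left_injective (t N)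
  rw [Finset.card_image_of_injective _ hinj, Finset.image_image]
  have h1 : (F N).image ((fun x => g + x) ∘ fun x => x + t N) =
      ((F N).image (fun x => g + x)).image (fun x => x + t N) := by
    rw [Finset.image_image]
    congr 1; ext x
    simp [add_assoc]
  rw [h1, ← Finset.image_symmDiff _ _ hinj, Finset.card_image_of_injective _ hinj]

/-- The sets of a Følner sequence can be translated so that each has the visit frequency to the
cylinder at least `μ (cylinder G)`, and the translates again form a Følner sequence. -/
lemma measureReal_cylinder_le [Countable G] {A : Set G} (hA : 0 < upperBanachDensity A)
    {μ : ProbabilityMeasure (ShiftSpace G)} (hμ : μ ∈ orbitMeasures G (point A)) :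
    (μ : Measure (ShiftSpace G)).real (cylinder G) ≤ upperBanachDensity A := by
  classical
  obtain ⟨F, hF, -⟩ := exists_isFolnerSeq_of_lt_upperBanachDensity hA hA
  choose t ht using fun N =>
    exists_le_visitFreq_of_mem_orbitMeasures hμ isClopen_cylinder (hF.nonempty N)
  refine le_trans ?_ (upperDensityAlong_le_upperBanachDensity (hF.image_add t) A)
  rw [upperDensityAlong_eq]
  refine le_limsup_of_frequently_le (Frequently.of_forall fun N => ?_)
    (isBoundedUnder_visitFreq _ A)
  rw [← visitFreq_vadd_point]
  exact ht N

/-- Følner sequences with upper density close to the upper Banach density give invariant measures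
that almost attain the bound; by compactness it is attained. -/
lemma exists_measureReal_cylinder_eq [Countable G] {A : Set G} (hA : 0 < upperBanachDensity A) :
    ∃ μ ∈ orbitMeasures G (point A),
      (μ : Measure (ShiftSpace G)).real (cylinder G) = upperBanachDensity A := by
  have happrox : ∀ c < upperBanachDensity A, ∃ μ ∈ orbitMeasures G (point A),
      c ≤ (μ : Measure (ShiftSpace G)).real (cylinder G) := by
    intro c hc
    obtain ⟨F, hF, hcF⟩ := exists_isFolnerSeq_of_lt_upperBanachDensity hA hc
    rw [upperDensityAlong_eq] at hcF
    refine exists_mem_orbitMeasures_of_frequently _ isClopen_cylinder (hF.tendsto.frequently ?_)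
    exact (frequently_lt_of_lt_limsup (isCoboundedUnder_visitFreq F A) hcF).mono fun N h => h.le
  obtain ⟨μ₁, hμ₁, -⟩ := happrox 0 hA
  obtain ⟨μ, hμ, hmax⟩ := (isCompact_orbitMeasures (point A)).exists_isMaxOn ⟨μ₁, hμ₁⟩
    (continuous_measureReal_of_isClopen isClopen_cylinder).continuousOn
  refine ⟨μ, hμ, le_antisymm (measureReal_cylinder_le hA hμ) (le_of_forall_lt fun c hc => ?_)⟩
  obtain ⟨c', hcc', hc'⟩ := exists_between hc
  obtain ⟨ν, hν, h⟩ := happrox c' hc'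
  exact hcc'.trans_le (h.trans (hmax hν))

/-- A limit along the Følner filter is a uniform Cesàro limit. -/
lemma Filter.Tendsto.hasUCLim {v : G → ℝ} {l : ℝ}
    (h : Tendsto (fun F => avg F v) (folnerFilter G) (𝓝 l)) : HasUCLim v l :=
  fun F hF => (h.comp hF.tendsto).congr fun N => avg_eq_div (F N) v

end ShiftSystem

open ShiftSpace in
theorem mainTheorem8 {G : Type u} [AddCommGroup G] [Countable G]
    (A : Set G) (hA : 0 < upperBanachDensity A)
    (φ₁ φ₂ φ₃ : AddMonoid.End G)
    (h₁₂ : Commute φ₁ φ₂) (h₁₃ : Commute φ₁ φ₃) (h₂₃ : Commute φ₂ φ₃)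
    (hφ₁ : (AddMonoidHom.range φ₁).FiniteIndex)
    (hφ₂ : (AddMonoidHom.range φ₂).FiniteIndex)
    (hφ₃ : (AddMonoidHom.range φ₃).FiniteIndex)
    (hsum : φ₁ + φ₂ + φ₃ = 0) :
    ∃ (X : Type u) (_ : MeasurableSpace X) (_ : AddAction G X) (μ : Measure X) (f : X → ℝ),
      IsErgodicSystem G X μ ∧
      Measurable f ∧ (∀ x, f x ∈ Set.Icc (0 : ℝ) 1) ∧
      ∫ x, f x ∂μ = upperBanachDensity A ∧
      ∃ I : G → ℝ,
        (∀ w, I w ∈ Set.Icc (0 : ℝ) 1) ∧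
        (∀ w, HasUCLim
          (fun g => ∫ x, f x * f (φ₃ g +ᵥ x) * f ((w - φ₂ g) +ᵥ x) ∂μ) (I w)) ∧
        φ₃ '' Function.support I ⊆ φ₁ '' A + φ₂ '' A + φ₃ '' A := by
  obtain ⟨μ, hμ, hμA, herg⟩ := exists_ergodic_of_isMax (G := G) (a := point A)
    (isClopen_cylinder (G := G)) (fun ν hν => measureReal_cylinder_le hA hν)
    (exists_measureReal_cylinder_eq hA)
  have hCm : MeasurableSet (cylinder G) := isClopen_cylinder.isOpen.measurableSet
  set f : ShiftSpace G → ℝ := (cylinder G).indicator 1 with hf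
  have hfm : Measurable f := measurable_one.indicator hCm
  have hf0 : ∀ x, 0 ≤ f x := fun x => Set.indicator_nonneg (fun _ _ => zero_le_one) x
  have hf1 : ∀ x, f x ≤ 1 := fun x => Set.indicator_le_self' (fun _ _ => zero_le_one) x
  have hfb : IsUnitBounded f := ⟨hfm, fun x => by rw [abs_of_nonneg (hf0 x)]; exact hf1 x⟩
  set u : G → G → ℝ := fun w g =>
    ∫ x, f x * f (φ₃ g +ᵥ x) * f ((w - φ₂ g) +ᵥ x) ∂(μ : Measure (ShiftSpace G)) with hu
  have hrel : ∀ g, φ₁ g + φ₂ g + φ₃ g = 0 := fun g => DFunLike.congr_fun hsum g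
  have hlim : ∀ w, ∃ l, Tendsto (fun F => avg F (u w)) (folnerFilter G) (𝓝 l) := by
    intro w
    have h := hasCauchyAvg_triple_correlation (μ := (μ : Measure (ShiftSpace G))) φ₃
      (negAddMonoidHom.comp φ₂) φ₁ (fun g => by
        change -φ₂ g - φ₃ g = φ₁ g
        rw [eq_comm, ← sub_eq_zero, ← hrel g]; abel) hφ₁ hfb hfb (hfb.vadd w)
    refine HasCauchyAvg.exists_tendsto ?_
    have e : ∀ g, w + (negAddMonoidHom.comp φ₂ : G →+ G) g = w - φ₂ g :=
      fun g => (sub_eq_add_neg _ _).symm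
    simp only [vadd_vadd, e] at h
    exact h
  choose I hI using hlim
  have hne : (folnerFilter G).NeBot := by
    obtain ⟨F, hF, -⟩ := exists_isFolnerSeq_of_lt_upperBanachDensity hA hA
    exact hF.tendsto.neBot
  have hu0 : ∀ w g, 0 ≤ u w g := fun w g =>
    integral_nonneg fun x => mul_nonneg (mul_nonneg (hf0 _) (hf0 _)) (hf0 _)
  have hu1 : ∀ w g, ‖u w g‖ ≤ 1 := by
    intro w g
    have hb := ((hfb.mul (hfb.vadd (φ₃ g))).mul (hfb.vadd (w - φ₂ g))).abs_le
    simpa using norm_integral_le_of_norm_le_const (μ := (μ : Measure (ShiftSpace G)))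
      (C := 1)
      (Eventually.of_forall fun x => (Real.norm_eq_abs _).trans_le (hb x))
  refine ⟨ShiftSpace G, inferInstance, inferInstance, μ, f,
    ⟨inferInstance, inferInstance, fun g => measurable_const_vadd g, herg⟩, hfm,
    fun x => ⟨hf0 x, hf1 x⟩, ?_, I, fun w => ⟨?_, ?_⟩, fun w => (hI w).hasUCLim, ?_⟩
  · rw [hf, integral_indicator_one hCm, hμA]
  · exact ge_of_tendsto (hI w) (Eventually.of_forall fun F => avg_nonneg fun g _ => hu0 w g)
  · exact le_of_tendsto (hI w) (Eventually.of_forall fun F =>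
      (Real.le_norm_self _).trans (norm_avg_le zero_le_one fun g _ => hu1 w g))
  · rintro _ ⟨w, hw, rfl⟩
    obtain ⟨g, hg⟩ : ∃ g, u w g ≠ 0 := by
      by_contra! h
      refine hw (tendsto_nhds_unique (hI w) (tendsto_const_nhds.congr fun F => ?_))
      simp [avg, h]
    set C : Set (ShiftSpace G) :=
      cylinder G ∩ (φ₃ g +ᵥ ·) ⁻¹' cylinder G ∩ ((w - φ₂ g) +ᵥ ·) ⁻¹' cylinder G with hC
    have hCc : IsClopen C := (isClopen_cylinder.inter
      (isClopen_cylinder.preimage_vadd _)).inter (isClopen_cylinder.preimage_vadd _)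
    -- otherwise `C` is null, and the triple correlation at `g` vanishes
    obtain ⟨t, ht⟩ : ∃ t : G, t +ᵥ point A ∈ C := by
      by_contra! h
      have h0 : (μ : Measure (ShiftSpace G)) C = 0 :=
        (measureReal_eq_zero_iff).1 (hμ.2 C hCc h)
      refine hg (integral_eq_zero_of_ae ?_)
      filter_upwards [measure_eq_zero_iff_ae_notMem.1 h0] with x hx
      by_contra hne
      refine hx ⟨⟨?_, ?_⟩, ?_⟩ <;> by_contra hmem <;> refine hne ?_
      · simp [hf, hmem]
      · have : f (φ₃ g +ᵥ x) = 0 := Set.indicator_of_notMem (s := cylinder G) hmem _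
        simp [this]
      · have : f ((w - φ₂ g) +ᵥ x) = 0 := Set.indicator_of_notMem (s := cylinder G) hmem _
        simp [this]
    obtain ⟨⟨ht1, ht2⟩, ht3⟩ := ht
    have m1 : t ∈ A := (vadd_point_mem_cylinder A t).1 ht1
    have m2 : φ₃ g + t ∈ A := (vadd_point_mem_cylinder A _).1 (by rw [add_vadd]; exact ht2)
    have m3 : w - φ₂ g + t ∈ A := (vadd_point_mem_cylinder A _).1 (by rw [add_vadd]; exact ht3)
    have hcomm : φ₂ (φ₃ g) = φ₃ (φ₂ g) := DFunLike.congr_fun h₂₃.eq g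
    have hw' : φ₃ w = φ₁ t + φ₂ (φ₃ g + t) + φ₃ (w - φ₂ g + t) := by
      calc φ₃ w = (φ₁ t + φ₂ t + φ₃ t) + φ₃ w := by rw [hrel, zero_add]
        _ = _ := by rw [map_add, map_add, map_sub, hcomm]; abel
    rw [hw']
    exact Set.add_mem_add (Set.add_mem_add ⟨_, m1, rfl⟩ ⟨_, m2, rfl⟩) ⟨_, m3, rfl⟩
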